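/- Let $\mathbf D=\{z\in\mathbb C:|z|<1\}$ be the hyperbolic disc, $B=\{b\in\mathbb C:|b|=1\}$ its boundary, and let $\Gamma$ be any group of orientation-preserving isometries of $\mathbf D$ (for instance a co-compact discrete subgroup of $PSU(1,1)$), acting on $\mathbf D$ and on $B$ by Moebius transformations. Let $r\in\mathbb C$ be such that $\tfrac12+ir\notin\{0,-1,-2,\dots\}$. (If $\tfrac14+r^2\ge 0$, as for the Laplace eigenvalues of a compact surface $\Gamma\backslash\mathbf D$, this only excludes $r=i/2$.) Let $\phi_{ir}:\mathbf D\to\mathbb C$ be a $\Gamma$-invariant function with Helgason (radial) boundary value $T_{ir}\in\mathcal D'(B)$, that is, $$\phi_{ir}(\gamma z)=\phi_{ir}(z)\quad(\gamma\in\Gamma,\ z\in\mathbf D),\qquad \phi_{ir}(z)=\int_B\Big(\frac{1-|z|^2}{|z-b|^2}\Big)^{\frac12+ir}\,T_{ir}(db)\quad(z\in\mathbf D);$$ in particular $\triangle\phi_{ir}=-(\tfrac14+r^2)\phi_{ir}$ for the hyperbolic Laplacian $\triangle$. Let $\Delta\subset B\times B$ be the diagonal. Then the distribution $$ps_{ir}(db',db)=\frac{T_{ir}(db)\,T_{ir}(db')}{|b-b'|^{1+2ir}}$$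 on $B\times B\setminus\Delta$ is invariant under the diagonal action $(b',b)\mapsto(\gamma b',\gamma b)$ of every $\gamma\in\Gamma$, and under time reversal $(b',b)\mapsto(b,b')$. -/

import Mathlib

open Complex ComplexConjugate Manifold ContDiff Matrix
open scoped Complex.UnitDisc

noncomputable section

namespace PattersonSullivan

/-- The group `SU(1,1)`: complex matrices `!![α, β; conj β, conj α]` of determinant one. It acts on
the unit disc and on its boundary circle through `PSU(1,1) = SU(1,1) / {1, -1}`, the group of
orientation-preserving isometries of the hyperbolic disc. -/
def SU11 : Subgroup (Matrix.SpecialLinearGroup (Fin 2) ℂ) where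
  carrier := {g | g 1 0 = conj (g 0 1) ∧ g 1 1 = conj (g 0 0)}
  mul_mem' := by
    rintro a b ⟨h1, h2⟩ ⟨h3, h4⟩
    constructor <;> simp [Matrix.mul_apply, Fin.sum_univ_two, h1, h2, h3, h4] <;> ring
  one_mem' := by simp
  inv_mem' := by
    rintro a ⟨h1, h2⟩
    constructor <;> simp [Matrix.SpecialLinearGroup.coe_inv, Matrix.adjugate_fin_two, h1, h2]

namespace SU11

theorem normSq_sub (g : SU11) :
    normSq (g.1 0 0) - normSq (g.1 0 1) = 1 := by
  have h := g.1.det_coe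
  rw [Matrix.det_fin_two] at h
  have e1 : g.1 1 0 = conj (g.1 0 1) := g.2.1
  have e2 : g.1 1 1 = conj (g.1 0 0) := g.2.2
  rw [e1, e2, mul_conj, mul_conj] at h
  exact_mod_cast h

theorem normSq_denom (g : SU11) (z : ℂ) :
    normSq (conj (g.1 0 1) * z + conj (g.1 0 0))
      = normSq (g.1 0 0 * z + g.1 0 1) + (1 - normSq z) := by
  have h := normSq_sub g
  simp only [normSq_apply, add_re, add_im, mul_re, mul_im, conj_re, conj_im] at h ⊢
  linear_combination (1 - z.re * z.re - z.im * z.im) * h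

theorem denom_ne_zero (g : SU11) {z : ℂ} (hz : normSq z ≤ 1) :
    conj (g.1 0 1) * z + conj (g.1 0 0) ≠ 0 := by
  intro h0
  have h := normSq_denom g z
  rw [h0, map_zero] at h
  have h1 := normSq_nonneg (g.1 0 0 * z + g.1 0 1)
  have h2 : normSq (g.1 0 0 * z + g.1 0 1) = 0 := by linarith
  rw [normSq_eq_zero] at h2
  have h3 := normSq_sub g
  have h4 : ((normSq (g.1 0 0) - normSq (g.1 0 1) : ℝ) : ℂ) = 0 := by
    push_cast
    rw [← mul_conj, ← mul_conj]
    linear_combination g.1 0 0 * h0 - conj (g.1 0 1) * h2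
  rw [h3] at h4
  simp at h4

/-- The Moebius transformation `z ↦ (α z + β) / (conj β z + conj α)`. -/
def mobius (g : SU11) (z : ℂ) : ℂ :=
  (g.1 0 0 * z + g.1 0 1) / (g.1 1 0 * z + g.1 1 1)

theorem mobius_eq (g : SU11) (z : ℂ) : mobius g z =
    (g.1 0 0 * z + g.1 0 1) / (conj (g.1 0 1) * z + conj (g.1 0 0)) := by
  rw [mobius, g.2.1, g.2.2]

theorem norm_mobius_lt (g : SU11) (z : 𝔻) : ‖mobius g z‖ < 1 := by
  have hz := z.normSq_lt_one
  have h0 := denom_ne_zero g hz.le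
  rw [mobius_eq, norm_div, div_lt_one (norm_pos_iff.2 h0)]
  apply lt_of_pow_lt_pow_left₀ 2 (norm_nonneg _)
  rw [← normSq_eq_norm_sq, ← normSq_eq_norm_sq, normSq_denom]
  linarith

theorem norm_mobius_eq (g : SU11) (b : Circle) : ‖mobius g b‖ = 1 := by
  have hb : normSq (b : ℂ) = 1 := by simp
  have h0 := denom_ne_zero g hb.le
  rw [mobius_eq, norm_div, div_eq_one_iff_eq (norm_ne_zero_iff.2 h0)]
  apply (sq_eq_sq₀ (norm_nonneg _) (norm_nonneg _)).1
  rw [← normSq_eq_norm_sq, ← normSq_eq_norm_sq, normSq_denom, hb]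
  ring

/-- The action of `SU(1,1)` on the unit disc. -/
def discMap (g : SU11) (z : 𝔻) : 𝔻 := UnitDisc.mk (mobius g z) (norm_mobius_lt g z)

/-- The action of `SU(1,1)` on the boundary circle. -/
def circleMap (g : SU11) (b : Circle) : Circle :=
  ⟨mobius g b, mem_sphere_zero_iff_norm.2 (norm_mobius_eq g b)⟩

end SU11

theorem contMDiff_circle_coe : ContMDiff (𝓡 1) 𝓘(ℝ, ℂ) ∞ (fun b : Circle => (b : ℂ)) :=
  have := finrank_real_complex_fact'
  contMDiff_coe_sphere (E := ℂ)

theorem SU11.contMDiff_circleMap (g : SU11) : ContMDiff (𝓡 1) (𝓡 1) ∞ (circleMap g) := by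
  have := finrank_real_complex_fact'
  have h : ContMDiff (𝓡 1) 𝓘(ℝ, ℂ) ∞ (fun b : Circle => mobius g b) := by
    intro b
    have hb := denom_ne_zero g (z := b) (by simp)
    have h2 : ContDiffAt ℂ ∞ (mobius g) (b : ℂ) := by
      have : mobius g = fun z => (g.1 0 0 * z + g.1 0 1) /
        (conj (g.1 0 1) * z + conj (g.1 0 0)) := funext (mobius_eq g)
      rw [this]
      exact ((contDiff_const.mul contDiff_id).add contDiff_const).contDiffAt.div
        ((contDiff_const.mul contDiff_id).add contDiff_const).contDiffAt hb
    exact (h2.restrict_scalars ℝ).contMDiffAt.comp b (contMDiff_circle_coe b)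
  exact ContMDiff.codRestrict_sphere h
    (fun b => mem_sphere_zero_iff_norm.2 (norm_mobius_eq g b))

theorem contMDiff_of_contDiff_exp {f : Circle → ℂ}
    (hf : ContDiff ℝ ∞ (fun θ : ℝ => f (Circle.exp θ))) : ContMDiff (𝓡 1) 𝓘(ℝ, ℂ) ∞ f := by
  intro b
  have h1 : ContMDiffAt 𝓘(ℝ, ℂ) 𝓘(ℝ, ℂ) ∞
      (fun z : ℂ => f (Circle.exp (arg (b : ℂ) + (log (z / b)).im))) (b : ℂ) := by
    apply ContDiffAt.contMDiffAt
    have h2 : ContDiffAt ℝ ∞ (fun z : ℂ => arg (b : ℂ) + (log (z / b)).im) (b : ℂ) := by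
      have h3 : ContDiffAt ℂ ∞ (fun z : ℂ => log (z / b)) (b : ℂ) := by
        exact (contDiffAt_log (by simp)).comp _ (contDiff_id.div_const _).contDiffAt
      exact contDiffAt_const.add (imCLM.contDiff.contDiffAt.comp _ (h3.restrict_scalars ℝ))
    exact hf.contDiffAt.comp _ h2
  have h4 := h1.comp b (contMDiff_circle_coe b)
  convert h4 using 1
  funext c
  simp only [Function.comp]
  congr 1
  have h5 : ((c : ℂ) / b) = ((c / b : Circle) : ℂ) := by simp
  rw [log_im, h5, Circle.exp_add, Circle.exp_arg, Circle.exp_arg]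
  simp

/-- The smooth complex-valued functions on the circle `B`. -/
def SmoothB : Submodule ℂ (Circle → ℂ) where
  carrier := {f | ContMDiff (𝓡 1) 𝓘(ℝ, ℂ) ∞ f}
  add_mem' hf hg := ContMDiff.add hf hg
  zero_mem' := contMDiff_const
  smul_mem' c _ hf := ((contDiff_const_smul c).contMDiff (E := ℂ) (𝕜 := ℝ)).comp hf

/-- A distribution on the circle `B`: a linear functional on the smooth functions that is continuous
for the topology of uniform convergence of all angular derivatives. -/
structure BoundaryDistribution where
  toLinearMap : SmoothB →ₗ[ℂ] ℂ
  bound : ∃ (C : ℝ) (N : ℕ), ∀ (f : SmoothB) (M : ℝ),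
    (∀ k ≤ N, ∀ θ : ℝ, ‖iteratedDeriv k (fun t : ℝ => f.1 (Circle.exp t)) θ‖ ≤ M) →
      ‖toLinearMap f‖ ≤ C * M

/-- The test functions on `B × B` minus the diagonal: smooth functions on `B × B` whose support (which
is compact, as `B × B` is) does not meet the diagonal. Points are written `(b', b)`. -/
def OffDiagTest : Submodule ℂ (Circle × Circle → ℂ) where
  carrier := {F | ContMDiff ((𝓡 1).prod (𝓡 1)) 𝓘(ℝ, ℂ) ∞ F ∧ tsupport F ⊆ {p | p.1 ≠ p.2}}
  add_mem' := fun {F G} hF hG => ⟨ContMDiff.add hF.1 hG.1,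
    (tsupport_add F G).trans (Set.union_subset hF.2 hG.2)⟩
  zero_mem' := ⟨contMDiff_const, by simp [tsupport]⟩
  smul_mem' c F hF := ⟨((contDiff_const_smul c).contMDiff (E := ℂ) (𝕜 := ℝ)).comp hF.1,
    (tsupport_smul_subset_right (fun _ => c) F).trans hF.2⟩

/-- A distribution on `B × B` minus the diagonal: a linear functional on the test functions that, on
the test functions supported in any fixed compact set `K`, is continuous for the topology of uniform
convergence of all derivatives. -/
structure GeodesicDistribution where
  toLinearMap : OffDiagTest →ₗ[ℂ] ℂ
  bound : ∀ K : Set (Circle × Circle), IsCompact K → K ⊆ {p | p.1 ≠ p.2} →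
    ∃ (C : ℝ) (N : ℕ), ∀ (F : OffDiagTest) (M : ℝ), tsupport F.1 ⊆ K →
      (∀ k ≤ N, ∀ p : ℝ × ℝ,
        ‖iteratedFDeriv ℝ k (fun q : ℝ × ℝ => F.1 (Circle.exp q.1, Circle.exp q.2)) p‖ ≤ M) →
      ‖toLinearMap F‖ ≤ C * M

theorem OffDiagTest.comp_mem {f : Circle × Circle → Circle × Circle}
    (hf : ContMDiff ((𝓡 1).prod (𝓡 1)) ((𝓡 1).prod (𝓡 1)) ∞ f)
    (hd : ∀ p, p.1 = p.2 → (f p).1 = (f p).2) (F : OffDiagTest) :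
    (fun p => F.1 (f p)) ∈ OffDiagTest :=
  ⟨F.2.1.comp hf, fun p hp h' =>
    F.2.2 (tsupport_comp_subset_preimage F.1 hf.continuous hp) (hd p h')⟩

/-- The test function `(b', b) ↦ F (b, b')`. -/
def OffDiagTest.swap (F : OffDiagTest) : OffDiagTest :=
  ⟨fun p => F.1 (p.2, p.1),
    comp_mem (contMDiff_snd.prodMk contMDiff_fst) (fun _ h => h.symm) F⟩

/-- The test function `(b', b) ↦ F (g b', g b)`. -/
def OffDiagTest.translate (g : SU11) (F : OffDiagTest) : OffDiagTest :=
  ⟨fun p => F.1 (SU11.circleMap g p.1, SU11.circleMap g p.2),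
    comp_mem (((SU11.contMDiff_circleMap g).comp contMDiff_fst).prodMk
      ((SU11.contMDiff_circleMap g).comp contMDiff_snd))
      (fun _ h => congrArg (SU11.circleMap g) h) F⟩

/-- The generalized Poisson kernel (non-Euclidean plane wave)
`P(z, b) ^ (1 / 2 + i r)`, where `P(z, b) = (1 - |z| ^ 2) / |z - b| ^ 2 > 0`. -/
def poissonWave (r : ℂ) (z : 𝔻) (b : Circle) : ℂ :=
  (((1 - ‖(z : ℂ)‖ ^ 2) / ‖(z : ℂ) - b‖ ^ 2 : ℝ) : ℂ) ^ (1 / 2 + I * r)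

theorem poissonWave_mem (r : ℂ) (z : 𝔻) : poissonWave r z ∈ SmoothB := by
  change ContMDiff (𝓡 1) 𝓘(ℝ, ℂ) ∞ (poissonWave r z)
  intro b
  have hne : (z : ℂ) - b ≠ 0 := by
    intro h
    have h1 := z.norm_lt_one
    rw [sub_eq_zero.1 h] at h1
    exact absurd (Circle.norm_coe b) h1.ne
  have hpos : 0 < (1 - ‖(z : ℂ)‖ ^ 2) / ‖(z : ℂ) - b‖ ^ 2 :=
    div_pos (by linarith [z.sq_norm_lt_one]) (by positivity)
  have h1 : ContDiffAt ℝ ∞ (fun w : ℂ => (1 - ‖(z : ℂ)‖ ^ 2) / ‖(z : ℂ) - w‖ ^ 2) (b : ℂ) :=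
    contDiffAt_const.div ((contDiff_const.sub contDiff_id).norm_sq ℝ).contDiffAt (by positivity)
  have h2 : ContDiffAt ℂ ∞ (fun w : ℂ => w ^ (1 / 2 + I * r))
      (((1 - ‖(z : ℂ)‖ ^ 2) / ‖(z : ℂ) - b‖ ^ 2 : ℝ) : ℂ) := by
    apply AnalyticAt.contDiffAt
    exact analyticAt_id.cpow analyticAt_const (ofReal_mem_slitPlane.2 hpos)
  have h3 : ContDiffAt ℝ ∞ (fun w : ℂ =>
      (((1 - ‖(z : ℂ)‖ ^ 2) / ‖(z : ℂ) - w‖ ^ 2 : ℝ) : ℂ) ^ (1 / 2 + I * r)) (b : ℂ) :=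
    ContDiffAt.comp (g := fun w : ℂ => w ^ (1 / 2 + I * r)) (f := fun w : ℂ =>
      (((1 - ‖(z : ℂ)‖ ^ 2) / ‖(z : ℂ) - w‖ ^ 2 : ℝ) : ℂ)) (b : ℂ) (h2.restrict_scalars ℝ) (ofRealCLM.contDiff.contDiffAt.comp _ h1)
  exact h3.contMDiffAt.comp b (contMDiff_circle_coe b)

/-- `T` is the Helgason (radial) boundary value of `φ` for the spectral parameter `r`, that is
`φ(z) = ∫ P(z, b) ^ (1 / 2 + i r) T(db)` for all `z` in the disc. (Then `φ` is automatically an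
eigenfunction of the hyperbolic Laplacian: `Δ φ = -(1 / 4 + r ^ 2) φ`.) -/
def IsHelgasonBoundaryValue (r : ℂ) (φ : 𝔻 → ℂ) (T : BoundaryDistribution) : Prop :=
  ∀ z : 𝔻, φ z = T.toLinearMap ⟨poissonWave r z, poissonWave_mem r z⟩

theorem hasDerivAt_fst {f : ℝ × ℝ → ℂ} (hf : ContDiff ℝ ∞ f) (x y : ℝ) :
    HasDerivAt (fun t => f (t, y)) (fderiv ℝ f (x, y) (1, 0)) x :=
  ((hf.differentiable (by simp)) (x, y)).hasFDerivAt.comp_hasDerivAt x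
    ((hasDerivAt_id x).prodMk (hasDerivAt_const x y))

theorem hasDerivAt_snd {f : ℝ × ℝ → ℂ} (hf : ContDiff ℝ ∞ f) (x y : ℝ) :
    HasDerivAt (fun t => f (x, t)) (fderiv ℝ f (x, y) (0, 1)) y :=
  ((hf.differentiable (by simp)) (x, y)).hasFDerivAt.comp_hasDerivAt y
    ((hasDerivAt_const y x).prodMk (hasDerivAt_id y))

theorem contDiff_fderiv_vec {f : ℝ × ℝ → ℂ} (hf : ContDiff ℝ ∞ f) (v : ℝ × ℝ) :
    ContDiff ℝ ∞ (fun p => fderiv ℝ f p v) :=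
  (hf.fderiv_right (m := ∞) (by simp)).clm_apply contDiff_const

theorem fderiv_vec_comm {f : ℝ × ℝ → ℂ} (hf : ContDiff ℝ ∞ f) (v w : ℝ × ℝ) (p : ℝ × ℝ) :
    fderiv ℝ (fun q => fderiv ℝ f q v) p w = fderiv ℝ (fun q => fderiv ℝ f q w) p v := by
  have hd : DifferentiableAt ℝ (fderiv ℝ f) p :=
    ((hf.fderiv_right (m := ∞) (by simp)).differentiable (by simp)) p
  have hs : IsSymmSndFDerivAt ℝ f p := hf.contDiffAt.isSymmSndFDerivAt
    (by simpa using (WithTop.coe_le_coe.2 le_top : ((2 : ℕ∞) : WithTop ℕ∞) ≤ ∞))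
  have h1 (u : ℝ × ℝ) : fderiv ℝ (fun q => fderiv ℝ f q u) p =
      (fderiv ℝ (fderiv ℝ f) p).flip u := by
    rw [fderiv_clm_apply hd (differentiableAt_const u)]
    simp
  rw [h1, h1]
  exact hs w v

/-- A partial derivative in the second variable, iterated `k` times. -/
def partialSnd (f : ℝ × ℝ → ℂ) : ℕ → ℝ × ℝ → ℂ
  | 0 => f
  | k + 1 => fun p => fderiv ℝ (partialSnd f k) p (0, 1)

theorem contDiff_partialSnd {f : ℝ × ℝ → ℂ} (hf : ContDiff ℝ ∞ f) (k : ℕ) :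
    ContDiff ℝ ∞ (partialSnd f k) := by
  induction k with
  | zero => exact hf
  | succ k ih => exact contDiff_fderiv_vec ih _

theorem iteratedDeriv_snd {f : ℝ × ℝ → ℂ} (hf : ContDiff ℝ ∞ f) (k : ℕ) (x : ℝ) :
    iteratedDeriv k (fun y => f (x, y)) = fun y => partialSnd f k (x, y) := by
  induction k with
  | zero => simp [partialSnd]
  | succ k ih =>
    rw [iteratedDeriv_succ, ih]
    funext y
    exact (hasDerivAt_snd (contDiff_partialSnd hf k) x y).deriv

theorem partialSnd_comm {f : ℝ × ℝ → ℂ} (hf : ContDiff ℝ ∞ f) (k : ℕ) :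
    partialSnd (fun p => fderiv ℝ f p (1, 0)) k =
      fun p => fderiv ℝ (partialSnd f k) p (1, 0) := by
  induction k with
  | zero => rfl
  | succ k ih =>
    funext p
    simp only [partialSnd, ih]
    exact fderiv_vec_comm (contDiff_partialSnd hf k) _ _ p

theorem remainder_small {f : ℝ × ℝ → ℂ} (hf : ContDiff ℝ ∞ f) (x : ℝ) {s : Set ℝ}
    (hs : IsCompact s) {ε : ℝ} (hε : 0 < ε) : ∀ᶠ t in nhds x, ∀ y ∈ s,
      ‖f (t, y) - f (x, y) - (t - x : ℝ) * fderiv ℝ f (x, y) (1, 0)‖ ≤ ε * |t - x| := by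
  have hc := (contDiff_fderiv_vec hf (1, 0)).continuous
  have h1 : ∀ᶠ t in nhds x, ∀ y ∈ s,
      ‖fderiv ℝ f (t, y) (1, 0) - fderiv ℝ f (x, y) (1, 0)‖ < ε := by
    apply hs.eventually_forall_of_forall_eventually
    intro y _
    have hc2 : Continuous fun q : ℝ × ℝ =>
        ‖fderiv ℝ f (q.1, q.2) (1, 0) - fderiv ℝ f (x, q.2) (1, 0)‖ :=
      (hc.sub (hc.comp (by fun_prop : Continuous fun q : ℝ × ℝ => (x, q.2)))).norm
    exact hc2.continuousAt.eventually_lt continuousAt_const (by simpa using hε)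
  obtain ⟨δ, hδ, hb⟩ := Metric.eventually_nhds_iff_ball.1 h1
  filter_upwards [Metric.ball_mem_nhds x hδ] with t ht y hy
  have h2 := (convex_ball x δ).norm_image_sub_le_of_norm_hasDerivWithin_le
    (f := fun u => f (u, y) - (u - x : ℝ) * fderiv ℝ f (x, y) (1, 0))
    (f' := fun u => fderiv ℝ f (u, y) (1, 0) - fderiv ℝ f (x, y) (1, 0)) (C := ε)
    (fun u _ => by
      have h3 := ((hasDerivAt_id u).sub_const x).ofReal_comp.mul_const
        (fderiv ℝ f (x, y) (1, 0))
      have h4 := (hasDerivAt_fst hf u y).sub h3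
      simp only [ofReal_one, one_mul] at h4
      exact h4.hasDerivWithinAt)
    (fun u hu => (hb u hu y hy).le) (Metric.mem_ball_self hδ) ht
  rw [Real.norm_eq_abs] at h2
  refine le_of_eq_of_le ?_ h2
  congr 1
  simp
  ring

/-- Bounds over one period suffice. -/
theorem BoundaryDistribution.bound_period (T : BoundaryDistribution) :
    ∃ (C : ℝ) (N : ℕ), 0 ≤ C ∧ ∀ (f : SmoothB) (M : ℝ),
    (∀ k ≤ N, ∀ θ ∈ Set.Icc 0 (2 * Real.pi),
      ‖iteratedDeriv k (fun t : ℝ => f.1 (Circle.exp t)) θ‖ ≤ M) →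
      ‖T.toLinearMap f‖ ≤ C * M := by
  obtain ⟨C, N, h⟩ := T.bound
  refine ⟨|C|, N, abs_nonneg C, fun f M hM => ?_⟩
  have hM0 : 0 ≤ M := (norm_nonneg _).trans (hM 0 (Nat.zero_le _) 0 (by simp [Real.pi_pos.le]))
  refine (h f M fun k hk θ => ?_).trans (mul_le_mul_of_nonneg_right (le_abs_self C) hM0)
  have hp : Function.Periodic (iteratedDeriv k (fun t : ℝ => f.1 (Circle.exp t)))
      (2 * Real.pi) := by
    intro t
    have := congrFun (iteratedDeriv_comp_add_const k
      (fun t : ℝ => f.1 (Circle.exp t)) (2 * Real.pi)) t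
    rw [← this]
    simp
  obtain ⟨y, hy, he⟩ := hp.exists_mem_Ico₀ Real.two_pi_pos θ
  rw [he]
  exact hM k hk y ⟨hy.1, hy.2.le⟩

/-- A family of functions on the circle that is smooth jointly in the parameter and the angle. -/
def SmoothFamily (g : ℝ → Circle → ℂ) : Prop :=
  ContDiff ℝ ∞ (fun p : ℝ × ℝ => g p.1 (Circle.exp p.2))

namespace SmoothFamily

variable {g : ℝ → Circle → ℂ}

theorem mem (hg : SmoothFamily g) (x : ℝ) : g x ∈ SmoothB :=
  contMDiff_of_contDiff_exp (ContDiff.comp (g := fun p : ℝ × ℝ => g p.1 (Circle.exp p.2))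
    (f := fun y : ℝ => (x, y)) hg (contDiff_const.prodMk contDiff_id))

theorem deriv_eq (hg : SmoothFamily g) (x y : ℝ) :
    deriv (fun t => g t (Circle.exp y)) x =
      fderiv ℝ (fun p : ℝ × ℝ => g p.1 (Circle.exp p.2)) (x, y) (1, 0) :=
  (hasDerivAt_fst hg x y).deriv

theorem deriv (hg : SmoothFamily g) : SmoothFamily (fun x b => _root_.deriv (fun t => g t b) x) := by
  have := contDiff_fderiv_vec hg (1, 0)
  unfold SmoothFamily
  simpa only [hg.deriv_eq] using this

theorem hasDerivAt (hg : SmoothFamily g) (T : BoundaryDistribution) (x : ℝ) :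
    HasDerivAt (fun t => T.toLinearMap ⟨g t, hg.mem t⟩)
      (T.toLinearMap ⟨fun b => _root_.deriv (fun t => g t b) x, hg.deriv.mem x⟩) x := by
  obtain ⟨C, N, hC, hT⟩ := T.bound_period
  set f : ℝ × ℝ → ℂ := fun p => g p.1 (Circle.exp p.2) with hf
  have hfs : ContDiff ℝ ∞ f := hg
  rw [hasDerivAt_iff_isLittleO, Asymptotics.isLittleO_iff]
  intro c hc
  have hε : 0 < c / (C + 1) := by positivity
  have h1 : ∀ᶠ t in nhds x, ∀ k ∈ Set.Iic N, ∀ y ∈ Set.Icc 0 (2 * Real.pi),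
      ‖partialSnd f k (t, y) - partialSnd f k (x, y) -
        (t - x : ℝ) * fderiv ℝ (partialSnd f k) (x, y) (1, 0)‖ ≤ c / (C + 1) * |t - x| :=
    (Filter.eventually_all_finite (Set.finite_Iic N)).2 fun k _ =>
      remainder_small (contDiff_partialSnd hfs k) x isCompact_Icc hε
  filter_upwards [h1] with t ht
  have h2 := hT (⟨g t, hg.mem t⟩ - ⟨g x, hg.mem x⟩ - ((t - x : ℝ) : ℂ) •
    ⟨fun b => _root_.deriv (fun t => g t b) x, hg.deriv.mem x⟩) (c / (C + 1) * |t - x|)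
    (fun k hk y hy => by
      refine le_of_eq_of_le ?_ (ht k hk y hy)
      congr 1
      have e : (fun s : ℝ => ((⟨g t, hg.mem t⟩ - ⟨g x, hg.mem x⟩ - ((t - x : ℝ) : ℂ) •
          ⟨fun b => _root_.deriv (fun t => g t b) x, hg.deriv.mem x⟩ : SmoothB) :
            Circle → ℂ) (Circle.exp s)) =
          fun s => f (t, s) - f (x, s) - ((t - x : ℝ) : ℂ) * fderiv ℝ f (x, s) (1, 0) := by
        funext s
        simp [hg.deriv_eq, hf]
      have hsl (f : ℝ × ℝ → ℂ) (h : ContDiff ℝ ∞ f) (x : ℝ) :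
          ContDiffAt ℝ k (fun s => f (x, s)) y :=
        ((h.comp (contDiff_const.prodMk contDiff_id)).of_le (by exact_mod_cast le_top)).contDiffAt
      have hd := contDiff_fderiv_vec hfs (1, 0)
      rw [e]
      have e2 : iteratedDeriv k (fun s => f (t, s) - f (x, s) -
          ((t - x : ℝ) : ℂ) * fderiv ℝ f (x, s) (1, 0)) y =
          iteratedDeriv k (fun s => f (t, s)) y - iteratedDeriv k (fun s => f (x, s)) y -
          ((t - x : ℝ) : ℂ) * iteratedDeriv k (fun s => fderiv ℝ f (x, s) (1, 0)) y := by
        rw [iteratedDeriv_fun_sub ((hsl f hfs t).sub (hsl f hfs x))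
          (contDiffAt_const.mul (hsl _ hd x)),
          iteratedDeriv_fun_sub (hsl f hfs t) (hsl f hfs x),
          iteratedDeriv_const_mul _ (hsl _ hd x)]
      rw [e2, iteratedDeriv_snd hfs, iteratedDeriv_snd hfs, iteratedDeriv_snd hd,
        partialSnd_comm hfs])
  rw [map_sub, map_sub, map_smul] at h2
  rw [Real.norm_eq_abs]
  refine (le_of_eq_of_le ?_ h2).trans ?_
  · congr 1
  · rw [← mul_assoc]
    refine mul_le_mul_of_nonneg_right ?_ (abs_nonneg _)
    rw [mul_div_assoc', div_le_iff₀ (by positivity)]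
    nlinarith

theorem contDiff (hg : SmoothFamily g) (T : BoundaryDistribution) :
    ContDiff ℝ ∞ (fun t => T.toLinearMap ⟨g t, hg.mem t⟩) := by
  rw [contDiff_infty]
  intro n
  induction n generalizing g with
  | zero =>
    exact contDiff_zero.2 (continuous_iff_continuousAt.2 fun x => (hg.hasDerivAt T x).continuousAt)
  | succ n ih =>
    push_cast
    rw [contDiff_succ_iff_deriv]
    refine ⟨fun x => (hg.hasDerivAt T x).differentiableAt, by simp, ?_⟩
    rw [funext fun x => (hg.hasDerivAt T x).deriv]
    exact ih hg.deriv

end SmoothFamily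

theorem norm_iteratedFDeriv_vec_le {f : ℝ × ℝ → ℂ} (hf : ContDiff ℝ ∞ f) {v : ℝ × ℝ}
    (hv : ‖v‖ ≤ 1) (n : ℕ) (p : ℝ × ℝ) :
    ‖iteratedFDeriv ℝ n (fun q => fderiv ℝ f q v) p‖ ≤ ‖iteratedFDeriv ℝ (n + 1) f p‖ := by
  have h := norm_iteratedFDeriv_clm_apply_const (c := v) (n := n) (N := ∞) (x := p)
    (hf.fderiv_right (m := ∞) (by simp)).contDiffAt (by exact_mod_cast le_top)
  rw [norm_iteratedFDeriv_fderiv] at h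
  exact h.trans (mul_le_of_le_one_left (norm_nonneg _) hv)

theorem norm_partialSnd_le {f : ℝ × ℝ → ℂ} (hf : ContDiff ℝ ∞ f) (l n : ℕ) (p : ℝ × ℝ) :
    ‖iteratedFDeriv ℝ n (partialSnd f l) p‖ ≤ ‖iteratedFDeriv ℝ (n + l) f p‖ := by
  induction l generalizing n with
  | zero => exact le_rfl
  | succ l ih =>
    refine (norm_iteratedFDeriv_vec_le (contDiff_partialSnd hf l) (by simp) n p).trans ?_
    refine (ih (n + 1)).trans_eq ?_
    rw [add_right_comm, add_assoc]

theorem SmoothFamily.norm_iteratedDeriv_le (T : BoundaryDistribution) :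
    ∃ (C : ℝ) (N : ℕ), 0 ≤ C ∧ ∀ (g : ℝ → Circle → ℂ) (hg : SmoothFamily g) (k : ℕ) (x M : ℝ),
      (∀ l ≤ N + k, ∀ y ∈ Set.Icc 0 (2 * Real.pi),
        ‖iteratedFDeriv ℝ l (fun p : ℝ × ℝ => g p.1 (Circle.exp p.2)) (x, y)‖ ≤ M) →
      ‖iteratedDeriv k (fun t => T.toLinearMap ⟨g t, hg.mem t⟩) x‖ ≤ C * M := by
  obtain ⟨C, N, hC, hT⟩ := T.bound_period
  refine ⟨C, N, hC, fun g hg k => ?_⟩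
  induction k generalizing g with
  | zero =>
    intro x M hM
    rw [iteratedDeriv_zero]
    refine hT _ M fun l hl y hy => ?_
    have h := norm_partialSnd_le hg l 0 (x, y)
    rw [norm_iteratedFDeriv_zero, zero_add] at h
    have e := congrFun (iteratedDeriv_snd hg l x) y
    simp only at e ⊢
    rw [e]
    exact h.trans (hM l hl y hy)
  | succ k ih =>
    intro x M hM
    rw [iteratedDeriv_succ', funext fun t => (hg.hasDerivAt T t).deriv]
    refine ih _ hg.deriv x M fun l hl y hy => ?_
    simp only [hg.deriv_eq]
    exact (norm_iteratedFDeriv_vec_le hg (by simp) l (x, y)).trans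
      (hM (l + 1) (by omega) y hy)

/-- The kernel `1 / |b' - b| ^ (1 + 2 i r)`. -/
def psKernel (r : ℂ) (b' b : Circle) : ℂ := 1 / ((‖(b' : ℂ) - b‖ : ℝ) : ℂ) ^ (1 + 2 * I * r)

theorem contMDiff_exp_prod : ContMDiff 𝓘(ℝ, ℝ × ℝ) ((𝓡 1).prod (𝓡 1)) ∞
    (fun q : ℝ × ℝ => (Circle.exp q.1, Circle.exp q.2)) :=
  (contMDiff_circleExp.comp contDiff_fst.contMDiff).prodMk
    (contMDiff_circleExp.comp contDiff_snd.contMDiff)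

theorem OffDiagTest.contDiff (F : OffDiagTest) :
    ContDiff ℝ ∞ (fun q : ℝ × ℝ => F.1 (Circle.exp q.1, Circle.exp q.2)) :=
  (F.2.1.comp contMDiff_exp_prod).contDiff

theorem continuous_exp_prod :
    Continuous (fun q : ℝ × ℝ => (Circle.exp q.1, Circle.exp q.2)) := by fun_prop

theorem isOpen_offDiag : IsOpen {q : ℝ × ℝ | Circle.exp q.1 ≠ Circle.exp q.2} :=
  isOpen_ne_fun (by fun_prop) (by fun_prop)

theorem psKernel_contDiffAt (r : ℂ) {q : ℝ × ℝ} (hq : Circle.exp q.1 ≠ Circle.exp q.2) :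
    ContDiffAt ℝ ∞ (fun q : ℝ × ℝ => psKernel r (Circle.exp q.1) (Circle.exp q.2)) q := by
  have hc : ContDiff ℝ ∞ (fun t : ℝ => (Circle.exp t : ℂ)) := by
    simp only [Circle.coe_exp]
    exact (ofRealCLM.contDiff.mul contDiff_const).cexp
  have hne : (Circle.exp q.1 : ℂ) - Circle.exp q.2 ≠ 0 :=
    sub_ne_zero.2 fun h => hq (Circle.ext h)
  have h1 : ContDiffAt ℝ ∞ (fun q : ℝ × ℝ => ‖(Circle.exp q.1 : ℂ) - Circle.exp q.2‖) q :=
    ((hc.comp contDiff_fst).sub (hc.comp contDiff_snd)).contDiffAt.norm ℝ hne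
  have h2 : ContDiffAt ℂ ∞ (fun w : ℂ => 1 / w ^ (1 + 2 * I * r))
      ((‖(Circle.exp q.1 : ℂ) - Circle.exp q.2‖ : ℝ) : ℂ) := by
    have hs : ((‖(Circle.exp q.1 : ℂ) - Circle.exp q.2‖ : ℝ) : ℂ) ∈ slitPlane :=
      ofReal_mem_slitPlane.2 (norm_pos_iff.2 hne)
    refine AnalyticAt.contDiffAt ?_
    refine analyticAt_const.div (analyticAt_id.cpow analyticAt_const hs) ?_
    rw [Ne, cpow_eq_zero_iff]
    exact fun h => slitPlane_ne_zero hs h.1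
  exact ContDiffAt.comp (g := fun w : ℂ => 1 / w ^ (1 + 2 * I * r)) (f := fun q : ℝ × ℝ =>
    ((‖(Circle.exp q.1 : ℂ) - Circle.exp q.2‖ : ℝ) : ℂ)) q (h2.restrict_scalars ℝ)
    (ofRealCLM.contDiff.contDiffAt.comp _ h1)

theorem OffDiagTest.eventually_zero (F : OffDiagTest) {q : ℝ × ℝ}
    (hq : (Circle.exp q.1, Circle.exp q.2) ∉ tsupport F.1) :
    ∀ᶠ p : ℝ × ℝ in nhds q, F.1 (Circle.exp p.1, Circle.exp p.2) = 0 := by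
  have h := (isClosed_tsupport F.1).isOpen_compl.preimage continuous_exp_prod
  filter_upwards [h.mem_nhds hq] with p hp
  exact image_eq_zero_of_notMem_tsupport hp

theorem OffDiagTest.mul_contDiff (r : ℂ) (F : OffDiagTest) :
    ContDiff ℝ ∞ (fun q : ℝ × ℝ => F.1 (Circle.exp q.1, Circle.exp q.2) *
      psKernel r (Circle.exp q.1) (Circle.exp q.2)) := by
  rw [contDiff_iff_contDiffAt]
  intro q
  by_cases hq : (Circle.exp q.1, Circle.exp q.2) ∈ tsupport F.1
  · exact (OffDiagTest.contDiff F).contDiffAt.mul (psKernel_contDiffAt r (F.2.2 hq))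
  · refine (contDiffAt_const (c := (0 : ℂ))).congr_of_eventuallyEq ?_
    filter_upwards [(OffDiagTest.eventually_zero F) hq] with p hp
    rw [hp, zero_mul]

theorem OffDiagTest.slice_mem (r : ℂ) (F : OffDiagTest) (b' : Circle) :
    (fun b => F.1 (b', b) * psKernel r b' b) ∈ SmoothB := by
  have h := SmoothFamily.mem (g := fun x b => F.1 (Circle.exp x, b) * psKernel r (Circle.exp x) b)
    (OffDiagTest.mul_contDiff r F) (arg b')
  simpa only [Circle.exp_arg] using h

/-- The function `b ↦ F (b', b) / |b' - b| ^ (1 + 2 i r)`. -/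
def OffDiagTest.slice (r : ℂ) (F : OffDiagTest) (b' : Circle) : SmoothB :=
  ⟨fun b => F.1 (b', b) * psKernel r b' b, OffDiagTest.slice_mem r F b'⟩

/-- The function `b' ↦ ∫ F (b', b) / |b' - b| ^ (1 + 2 i r) T(db)`. -/
def OffDiagTest.psInner (r : ℂ) (T : BoundaryDistribution) (F : OffDiagTest) : SmoothB :=
  ⟨fun b' => T.toLinearMap (OffDiagTest.slice r F b'), contMDiff_of_contDiff_exp
    (SmoothFamily.contDiff (g := fun x b => F.1 (Circle.exp x, b) * psKernel r (Circle.exp x) b)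
      (OffDiagTest.mul_contDiff r F) T)⟩

theorem iteratedFDeriv_mul_bound (r : ℂ) {K : Set (Circle × Circle)} (hK : IsCompact K)
    (hKd : K ⊆ {p | p.1 ≠ p.2}) (N : ℕ) :
    ∃ A : ℝ, ∀ (F : OffDiagTest) (M : ℝ), tsupport F.1 ⊆ K →
      (∀ k ≤ N, ∀ p : ℝ × ℝ,
        ‖iteratedFDeriv ℝ k (fun q : ℝ × ℝ => F.1 (Circle.exp q.1, Circle.exp q.2)) p‖ ≤ M) →
      ∀ k ≤ N, ∀ p ∈ Set.Icc 0 (2 * Real.pi) ×ˢ Set.Icc 0 (2 * Real.pi),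
        ‖iteratedFDeriv ℝ k (fun q : ℝ × ℝ => F.1 (Circle.exp q.1, Circle.exp q.2) *
          psKernel r (Circle.exp q.1) (Circle.exp q.2)) p‖ ≤ A * M := by
  set U := {q : ℝ × ℝ | Circle.exp q.1 ≠ Circle.exp q.2} with hU
  set κ : ℝ × ℝ → ℂ := fun q => psKernel r (Circle.exp q.1) (Circle.exp q.2) with hκ
  set L := (Set.Icc 0 (2 * Real.pi) ×ˢ Set.Icc 0 (2 * Real.pi)) ∩
    (fun q : ℝ × ℝ => (Circle.exp q.1, Circle.exp q.2)) ⁻¹' K with hL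
  have hLc : IsCompact L :=
    (isCompact_Icc.prod isCompact_Icc).inter_right (hK.isClosed.preimage continuous_exp_prod)
  have hLU : L ⊆ U := fun q hq => hKd hq.2
  have hκU : ContDiffOn ℝ ∞ κ U := fun q hq => (psKernel_contDiffAt r hq).contDiffWithinAt
  have hB : ∀ i : ℕ, ∃ B, ∀ q ∈ L, ‖iteratedFDerivWithin ℝ i κ U q‖ ≤ B := fun i =>
    hLc.exists_bound_of_continuousOn ((hκU.continuousOn_iteratedFDerivWithin
      (by exact_mod_cast le_top) isOpen_offDiag.uniqueDiffOn).mono hLU)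
  choose B hB using hB
  set S := ∑ i ∈ Finset.range (N + 1), |B i| with hS
  have hS0 : 0 ≤ S := Finset.sum_nonneg fun _ _ => abs_nonneg _
  have hBS : ∀ i ≤ N, ∀ q ∈ L, ‖iteratedFDerivWithin ℝ i κ U q‖ ≤ S := fun i hi q hq =>
    ((hB i q hq).trans (le_abs_self _)).trans
      (Finset.single_le_sum (f := fun i => |B i|) (fun _ _ => abs_nonneg _)
        (Finset.mem_range.2 (by omega)))
  refine ⟨2 ^ N * S, fun F M hF hM k hk p hp => ?_⟩
  have hM0 : 0 ≤ M := (norm_nonneg _).trans (hM 0 (Nat.zero_le _) 0)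
  by_cases hpL : p ∈ L
  · have hpU := hLU hpL
    have h1 := norm_iteratedFDerivWithin_mul_le ((OffDiagTest.contDiff F).contDiffOn (s := U)) hκU
      isOpen_offDiag.uniqueDiffOn hpU (n := k) (by exact_mod_cast le_top)
    rw [iteratedFDerivWithin_of_isOpen k isOpen_offDiag hpU] at h1
    refine h1.trans ?_
    calc _ ≤ ∑ i ∈ Finset.range (k + 1), (k.choose i : ℝ) * M * S := by
          refine Finset.sum_le_sum fun i hi => ?_
          rw [Finset.mem_range] at hi
          rw [iteratedFDerivWithin_of_isOpen i isOpen_offDiag hpU]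
          have h2 := hM i (by omega) p
          have h3 := hBS (k - i) (by omega) p hpL
          gcongr
      _ = 2 ^ k * S * M := by
          rw [← Finset.sum_mul, ← Finset.sum_mul, ← Nat.cast_sum, Nat.sum_range_choose]
          push_cast
          ring
      _ ≤ 2 ^ N * S * M := by
          gcongr
          norm_num
  · have hz : ∀ᶠ q in nhds p, F.1 (Circle.exp q.1, Circle.exp q.2) * κ q = 0 := by
      filter_upwards [OffDiagTest.eventually_zero F fun h => hpL ⟨hp, hF h⟩] with q hq
      rw [hq, zero_mul]
    have h0 : iteratedFDeriv ℝ k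
        (fun q : ℝ × ℝ => F.1 (Circle.exp q.1, Circle.exp q.2) * κ q) p = 0 := by
      have := Filter.EventuallyEq.iteratedFDeriv (𝕜 := ℝ) (f₂ := fun _ => (0 : ℂ)) hz k
      rw [this.eq_of_nhds]
      simp
    rw [h0, norm_zero]
    positivity

/-- The distribution `ps(db', db) = T(db) T(db') / |b - b'| ^ (1 + 2 i r)` on `B × B` minus the
diagonal: its value at a test function `F` is the iterated pairing
`∫ (∫ F (b', b) / |b' - b| ^ (1 + 2 i r) T(db)) T(db')`. -/
def psDistribution (r : ℂ) (T : BoundaryDistribution) : GeodesicDistribution where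
  toLinearMap :=
    { toFun := fun F => T.toLinearMap (OffDiagTest.psInner r T F)
      map_add' := fun F G => by
        rw [← map_add]
        congr 1
        ext b'
        change T.toLinearMap _ = T.toLinearMap _ + T.toLinearMap _
        rw [← map_add]
        congr 1
        ext b
        exact add_mul _ _ _
      map_smul' := fun c F => by
        rw [← map_smul]
        congr 1
        ext b'
        change T.toLinearMap _ = c • T.toLinearMap _
        rw [← map_smul]
        congr 1
        ext b
        exact mul_assoc _ _ _ }
  bound := fun K hK hKd => by
    obtain ⟨C₁, N₁, hC₁, h₁⟩ := T.bound_period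
    obtain ⟨C₂, N₂, hC₂, h₂⟩ := SmoothFamily.norm_iteratedDeriv_le T
    obtain ⟨A, hA⟩ := iteratedFDeriv_mul_bound r hK hKd (N₂ + N₁)
    refine ⟨C₁ * (C₂ * A), N₂ + N₁, fun F M hF hM => ?_⟩
    refine (h₁ (OffDiagTest.psInner r T F) (C₂ * (A * M)) fun k hk x hx => ?_).trans_eq (by ring)
    exact h₂ (fun x b => F.1 (Circle.exp x, b) * psKernel r (Circle.exp x) b)
      (OffDiagTest.mul_contDiff r F) k x (A * M) fun l hl y hy => hA F M hF hM l (by omega) (x, y) ⟨hx, hy⟩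

/-- Invariance under the diagonal action `(b', b) ↦ (γ b', γ b)` of the elements `γ` of `Γ`. -/
def GeodesicDistribution.IsInvariant (u : GeodesicDistribution) (Γ : Subgroup SU11) : Prop :=
  ∀ γ ∈ Γ, ∀ F : OffDiagTest, u.toLinearMap (OffDiagTest.translate γ F) = u.toLinearMap F

/-- Invariance under time reversal `(b', b) ↦ (b, b')`. -/
def GeodesicDistribution.IsTimeReversalInvariant (u : GeodesicDistribution) : Prop :=
  ∀ F : OffDiagTest, u.toLinearMap (OffDiagTest.swap F) = u.toLinearMap F

end PattersonSullivan

end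

open PattersonSullivan

/-!
Write `s = 1 / 2 + i r`, and let `w_γ(b) = |γ'(b)| ^ s` be the conformal weight of `γ` on the boundary
(which is itself a plane wave, namely the one at `γ⁻¹ 0`).

Invariance of the Patterson-Sullivan distribution under `γ` comes down to the equivariance
`T ((f ∘ γ) w_γ) = T f` of the boundary value, since the kernel `|b - b'| ^ (-2 s)` transforms by
`w_γ(b') w_γ(b)` (`psKernel_circleMap`). The plane waves satisfy
`P(γ z, γ b) ^ s w_γ(b) = P(z, b) ^ s` (`poissonWave_discMap`), so for `f` a plane wave equivariance is
precisely the invariance of `φ` under `γ`. That it then holds for every smooth `f` is the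
injectivity of the Poisson transform (`BoundaryDistribution.eq_zero_of_poissonWave`), applied to
the distribution `f ↦ T ((f ∘ γ) w_γ) - T f`: expanding
`|z - b| ^ (-2 s) = (1 - z / b) ^ (-s) (1 - conj z * b) ^ (-s)` in binomial series and comparing powers
of `|z|`, the vanishing of a distribution on all plane waves gives, by induction on `n`, the vanishing
of `(s)_n / n!` times its Fourier coefficients of frequencies `n` and `-n`. The condition on `r` says
that no Pochhammer symbol `(s)_n` vanishes.

Invariance under time reversal is Fubini's theorem for `T ⊗ T` on the torus
(`BoundaryDistribution.iterated_comm`): the double Fourier coefficients of a smooth function decay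
rapidly, so both iterated pairings equal the same absolutely convergent double series.
Both parts rest on the fact that a distribution can be applied term by term to a series of monomials
with rapidly decaying coefficients (`BoundaryDistribution.hasSum_monomialB`).
-/

noncomputable section

namespace PattersonSullivan

/-! ### Fourier monomials and absolutely convergent expansions -/

theorem coe_exp_zpow (k : ℤ) (θ : ℝ) :
    ((Circle.exp θ ^ k : Circle) : ℂ) = cexp (I * k * θ) := by
  rw [← Circle.exp_zsmul, Circle.coe_exp]
  congr 1
  push_cast [zsmul_eq_mul]
  ring

theorem contDiff_cexp_mul (a : ℂ) : ContDiff ℝ ∞ (fun θ : ℝ => cexp (a * θ)) :=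
  (contDiff_const.mul ofRealCLM.contDiff).cexp

theorem iteratedDeriv_cexp_mul (a : ℂ) (n : ℕ) :
    iteratedDeriv n (fun θ : ℝ => cexp (a * θ)) = fun θ : ℝ => a ^ n * cexp (a * θ) := by
  induction n with
  | zero => simp
  | succ n ih =>
    rw [iteratedDeriv_succ, ih]
    funext θ
    have h : HasDerivAt (fun θ : ℝ => a * (θ : ℂ)) (a * 1) θ :=
      (hasDerivAt_id θ).ofReal_comp.const_mul a
    rw [(h.cexp.const_mul (a ^ n)).deriv]
    ring

/-- The Fourier monomial `b ↦ b ^ k` on the circle, for an integer `k`. -/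
def monomialB (k : ℤ) : SmoothB :=
  ⟨fun b => ((b ^ k : Circle) : ℂ), contMDiff_of_contDiff_exp (by
    simp only [coe_exp_zpow]
    exact contDiff_cexp_mul _)⟩

theorem norm_iteratedFDeriv_cexp_le (k : ℤ) {n N : ℕ} (hn : n ≤ N) (θ : ℝ) :
    ‖iteratedFDeriv ℝ n (fun θ : ℝ => cexp (I * k * θ)) θ‖ ≤ (1 + |(k : ℝ)|) ^ N := by
  rw [norm_iteratedFDeriv_eq_norm_iteratedDeriv, iteratedDeriv_cexp_mul, norm_mul, norm_pow]
  have h : ‖cexp (I * k * θ)‖ = 1 := by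
    rw [← coe_exp_zpow]; simp
  rw [h, mul_one, norm_mul, norm_I, one_mul, norm_intCast]
  calc |(k : ℝ)| ^ n ≤ (1 + |(k : ℝ)|) ^ n := by gcongr; linarith
    _ ≤ _ := pow_le_pow_right₀ (by linarith [abs_nonneg (k : ℝ)]) hn

theorem BoundaryDistribution.norm_monomialB_le (T : BoundaryDistribution) :
    ∃ (C : ℝ) (N : ℕ), ∀ k : ℤ, ‖T.toLinearMap (monomialB k)‖ ≤ C * (1 + |(k : ℝ)|) ^ N := by
  obtain ⟨C, N, h⟩ := T.bound
  refine ⟨C, N, fun k => h _ _ fun n hn θ => ?_⟩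
  rw [← norm_iteratedFDeriv_eq_norm_iteratedDeriv]
  simp only [monomialB, coe_exp_zpow]
  exact norm_iteratedFDeriv_cexp_le k hn θ

/-- A distribution may be applied term by term to a series of monomials whose coefficients decay
faster than any power of the degree. The index type is arbitrary, so that double series are covered
as well. -/
theorem BoundaryDistribution.hasSum_monomialB (T : BoundaryDistribution) {ι : Type*} {c : ι → ℂ}
    {m : ι → ℤ} (hc : ∀ N : ℕ, Summable fun i => ‖c i‖ * (1 + |(m i : ℝ)|) ^ N)
    (f : SmoothB) (hf : ∀ b : Circle, f.1 b = ∑' i, c i * (monomialB (m i)).1 b) :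
    HasSum (fun i => c i * T.toLinearMap (monomialB (m i))) (T.toLinearMap f) := by
  obtain ⟨C, N, h⟩ := T.bound
  have hs : ∀ b : Circle, Summable fun i => c i * (monomialB (m i)).1 b := fun b =>
    Summable.of_norm (by simpa only [monomialB, norm_mul, Circle.norm_coe, pow_zero] using hc 0)
  -- the remainder of a partial sum is bounded in `C ^ N` by the tail of the majorant
  have key : ∀ s : Finset ι, ‖T.toLinearMap f - ∑ i ∈ s, c i * T.toLinearMap (monomialB (m i))‖ ≤
      C * ∑' i : {i // i ∉ s}, ‖c i‖ * (1 + |(m i : ℝ)|) ^ N := by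
    intro s
    have h1 := h (f - ∑ i ∈ s, c i • monomialB (m i))
      (∑' i : {i // i ∉ s}, ‖c i‖ * (1 + |(m i : ℝ)|) ^ N) fun n hn θ => by
        have e : (fun t : ℝ => (f - ∑ i ∈ s, c i • monomialB (m i)).1 (Circle.exp t)) =
            fun t : ℝ => ∑' i : {i // i ∉ s}, c i * cexp (I * m i * t) := by
          funext t
          have := (hs (Circle.exp t)).sum_add_tsum_subtype_compl s
          rw [← hf] at this
          simp only [monomialB, coe_exp_zpow] at this
          rw [← eq_sub_iff_add_eq'] at this
          rw [this, Submodule.coe_sub, Pi.sub_apply, Submodule.coe_sum, Finset.sum_apply]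
          simp only [Submodule.coe_smul, Pi.smul_apply, smul_eq_mul, monomialB, coe_exp_zpow]
        have hb : ∀ (k : ℕ) (i : {i // i ∉ s}) (x : ℝ), ‖iteratedFDeriv ℝ k
            (fun t : ℝ => c i * cexp (I * m i * t)) x‖ ≤ ‖c i‖ * (1 + |(m i : ℝ)|) ^ k := by
          intro k i x
          have := iteratedFDeriv_const_smul_apply' (x := x) (a := c i) (i := k) (𝕜 := ℝ)
            ((contDiff_cexp_mul (I * m i)).of_le (by exact_mod_cast le_top)).contDiffAt
          simp only [smul_eq_mul] at this
          rw [this, norm_smul]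
          exact mul_le_mul_of_nonneg_left (norm_iteratedFDeriv_cexp_le _ le_rfl _) (norm_nonneg _)
        have hsub : ∀ k : ℕ, Summable fun i : {i // i ∉ s} => ‖c i‖ * (1 + |(m i : ℝ)|) ^ k :=
          fun k => (hc k).subtype _
        rw [e, ← norm_iteratedFDeriv_eq_norm_iteratedDeriv,
          iteratedFDeriv_tsum_apply (N := ⊤)
            (v := fun k (i : {i // i ∉ s}) => ‖c i‖ * (1 + |(m i : ℝ)|) ^ k)
            (fun i => contDiff_const.mul (contDiff_cexp_mul _)) (fun k _ => hsub k)
            (fun k i x _ => hb k i x) le_top]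
        refine tsum_of_norm_bounded (hsub N).hasSum fun i => (hb n i θ).trans ?_
        gcongr
        linarith [abs_nonneg (m i : ℝ)]
    simpa using h1
  have hlim := (tendsto_tsum_compl_atTop_zero
    (fun i => ‖c i‖ * (1 + |(m i : ℝ)|) ^ N)).const_mul C
  rw [mul_zero] at hlim
  have := squeeze_zero_norm key hlim
  rw [HasSum]
  simpa using (tendsto_const_nhds (x := T.toLinearMap f)).sub this

/-! ### Fourier coefficients of periodic functions -/

/-- The Fourier coefficient `(2 π)⁻¹ ∫ f(θ) e ^ (-i k θ) dθ` over `[0, 2 π]`. -/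
def coeff (k : ℤ) (f : ℝ → ℂ) : ℂ :=
  (2 * Real.pi : ℝ)⁻¹ • ∫ θ in (0 : ℝ)..(2 * Real.pi), f θ * cexp (-(I * k * θ))

theorem norm_cexp_neg (k : ℤ) (θ : ℝ) : ‖cexp (-(I * k * θ))‖ = 1 := by
  have : -(I * k * θ) = ((-(k * θ) : ℝ) : ℂ) * I := by push_cast; ring
  rw [this, norm_exp_ofReal_mul_I]

theorem norm_coeff_le (k : ℤ) {f : ℝ → ℂ} {M : ℝ} (hM : ∀ θ, ‖f θ‖ ≤ M) : ‖coeff k f‖ ≤ M := by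
  have hp := Real.two_pi_pos
  have h := intervalIntegral.norm_integral_le_of_norm_le_const (a := 0) (b := 2 * Real.pi)
    (f := fun θ : ℝ => f θ * cexp (-(I * k * θ))) (C := M)
    (fun θ _ => by rw [norm_mul, norm_cexp_neg, mul_one]; exact hM θ)
  rw [sub_zero, abs_of_pos hp] at h
  rw [coeff, norm_smul, norm_inv, Real.norm_of_nonneg hp.le, inv_mul_le_iff₀ hp]
  linarith

theorem coeff_deriv (k : ℤ) {f f' : ℝ → ℂ} (hf : ∀ θ, HasDerivAt f (f' θ) θ)
    (hf' : Continuous f') (hp : Function.Periodic f (2 * Real.pi)) :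
    coeff k f' = I * k * coeff k f := by
  have hc : Continuous f := continuous_iff_continuousAt.2 fun θ => (hf θ).continuousAt
  have h1 : ∀ θ : ℝ, HasDerivAt (fun θ : ℝ => f θ * cexp (-(I * k * θ)))
      (f' θ * cexp (-(I * k * θ)) - I * k * (f θ * cexp (-(I * k * θ)))) θ := by
    intro θ
    have h : HasDerivAt (fun θ : ℝ => -(I * k * (θ : ℂ))) (-(I * k * 1)) θ :=
      ((hasDerivAt_id θ).ofReal_comp.const_mul (I * k)).neg
    refine ((hf θ).mul h.cexp).congr_deriv ?_
    ring
  have hi1 : Continuous fun θ : ℝ => f' θ * cexp (-(I * k * θ)) := by fun_prop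
  have hi2 : Continuous fun θ : ℝ => I * k * (f θ * cexp (-(I * k * θ))) := by fun_prop
  have h2 := intervalIntegral.integral_eq_sub_of_hasDerivAt (a := 0) (b := 2 * Real.pi)
    (fun θ _ => h1 θ) ((hi1.sub hi2).intervalIntegrable _ _)
  rw [intervalIntegral.integral_sub (hi1.intervalIntegrable _ _) (hi2.intervalIntegrable _ _),
    intervalIntegral.integral_const_mul] at h2
  have e : cexp (-(I * k * ((2 * Real.pi : ℝ) : ℂ))) = 1 := by
    rw [Complex.exp_eq_one_iff]
    exact ⟨-k, by push_cast; ring⟩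
  have hf0 : f (2 * Real.pi) = f 0 := by simpa using hp 0
  rw [e, hf0] at h2
  simp only [ofReal_zero, mul_zero, neg_zero, Complex.exp_zero, sub_self] at h2
  rw [coeff, coeff, sub_eq_zero.1 h2, mul_smul_comm]

theorem periodic_iteratedDeriv {f : ℝ → ℂ} {T : ℝ} (hp : Function.Periodic f T) (n : ℕ) :
    Function.Periodic (iteratedDeriv n f) T := by
  intro θ
  rw [← congrFun (iteratedDeriv_comp_add_const n f T) θ]
  congr 1
  exact funext hp

theorem exists_bound_of_periodic {f : ℝ → ℂ} (hf : Continuous f)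
    (hp : Function.Periodic f (2 * Real.pi)) : ∃ M, ∀ θ, ‖f θ‖ ≤ M := by
  obtain ⟨M, hM⟩ := (hp.compact_of_continuous Real.two_pi_pos.ne' hf).isBounded.exists_norm_le
  exact ⟨M, fun θ => hM _ ⟨θ, rfl⟩⟩

theorem coeff_iteratedDeriv (k : ℤ) {f : ℝ → ℂ} (hf : ContDiff ℝ ∞ f)
    (hp : Function.Periodic f (2 * Real.pi)) (n : ℕ) :
    coeff k (iteratedDeriv n f) = (I * k) ^ n * coeff k f := by
  induction n with
  | zero => simp
  | succ n ih =>
    rw [iteratedDeriv_succ, coeff_deriv k (f := iteratedDeriv n f), ih, pow_succ']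
    · ring
    · intro θ
      exact ((hf.differentiable_iteratedDeriv n
        (by exact_mod_cast WithTop.coe_lt_top _)) θ).hasDerivAt
    · rw [← iteratedDeriv_succ]
      exact hf.continuous_iteratedDeriv _ (by exact_mod_cast le_top)
    · exact periodic_iteratedDeriv hp n

theorem summable_inv_sq_int : Summable fun k : ℤ => ((1 + |(k : ℝ)|) ^ 2)⁻¹ := by
  have h := (Real.summable_one_div_int_pow (p := 2)).2 (by norm_num)
  refine (h.add (summable_of_hasFiniteSupport (f := fun k : ℤ => if k = 0 then (1 : ℝ) else 0)
    (Set.Finite.subset (Set.finite_singleton 0) (by intro k; simp)))).of_nonneg_of_le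
      (fun k => by positivity) fun k => ?_
  by_cases hk : k = 0
  · simp [hk]
  · have : 0 < |(k : ℝ)| := by positivity
    simp only [hk, if_false, add_zero, one_div]
    rw [← sq_abs (k : ℝ)]
    gcongr
    linarith

theorem natCast_le_infty (n : ℕ) : (n : WithTop ℕ∞) ≤ ∞ := by exact_mod_cast le_top

theorem summable_coeff {f : ℝ → ℂ} (hf : ContDiff ℝ ∞ f)
    (hp : Function.Periodic f (2 * Real.pi)) (N : ℕ) :
    Summable fun k : ℤ => ‖coeff k f‖ * (1 + |(k : ℝ)|) ^ N := by
  obtain ⟨M₀, hM₀⟩ := exists_bound_of_periodic hf.continuous hp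
  obtain ⟨M₁, hM₁⟩ := exists_bound_of_periodic (hf.continuous_iteratedDeriv (N + 2)
    (natCast_le_infty _)) (periodic_iteratedDeriv hp (N + 2))
  refine (summable_inv_sq_int.mul_left (2 ^ (N + 1) * (M₀ + M₁))).of_nonneg_of_le
    (fun k => by positivity) fun k => ?_
  have h0 := norm_coeff_le k hM₀
  have h1 := norm_coeff_le k hM₁
  rw [coeff_iteratedDeriv k hf hp, norm_mul, norm_pow, norm_mul, norm_I, one_mul,
    norm_intCast] at h1
  have hk := add_pow_le zero_le_one (abs_nonneg (k : ℝ)) (N + 2)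
  rw [one_pow] at hk
  rw [← div_eq_mul_inv, le_div_iff₀ (by positivity)]
  calc _ = ‖coeff k f‖ * (1 + |(k : ℝ)|) ^ (N + 2) := by ring
    _ ≤ ‖coeff k f‖ * (2 ^ (N + 1) * (1 + |(k : ℝ)| ^ (N + 2))) := by gcongr; exact hk
    _ = 2 ^ (N + 1) * (‖coeff k f‖ + |(k : ℝ)| ^ (N + 2) * ‖coeff k f‖) := by ring
    _ ≤ _ := mul_le_mul_of_nonneg_left (by linarith) (by positivity)

/-- The Fourier series of a smooth periodic function converges to it. -/
theorem hasSum_coeff {f : ℝ → ℂ} (hf : ContDiff ℝ ∞ f) (hp : Function.Periodic f (2 * Real.pi))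
    (θ : ℝ) : HasSum (fun k : ℤ => coeff k f * cexp (I * k * θ)) (f θ) := by
  have : Fact (0 < 2 * Real.pi) := ⟨Real.two_pi_pos⟩
  let F : C(AddCircle (2 * Real.pi), ℂ) :=
    ⟨hp.lift, continuous_coinduced_dom.2 hf.continuous⟩
  have hF : ∀ k, fourierCoeff F k = coeff k f := by
    intro k
    rw [fourierCoeff_eq_intervalIntegral _ _ 0, zero_add, coeff, one_div]
    congr 1
    refine intervalIntegral.integral_congr fun x _ => ?_
    have : F (x : AddCircle (2 * Real.pi)) = f x := rfl
    simp only [this, fourier_coe_apply, smul_eq_mul]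
    rw [mul_comm]
    congr 2
    have : (Real.pi : ℂ) ≠ 0 := by exact_mod_cast Real.pi_ne_zero
    push_cast
    field_simp
  have hs : Summable (fourierCoeff F) := by
    refine Summable.of_norm ?_
    simpa only [funext hF, pow_zero, mul_one] using summable_coeff hf hp 0
  have := has_pointwise_sum_fourier_series_of_summable hs (θ : AddCircle (2 * Real.pi))
  have e : ∀ k : ℤ, fourierCoeff F k • (fourier k (θ : AddCircle (2 * Real.pi)) : ℂ) =
      coeff k f * cexp (I * k * θ) := by
    intro k
    rw [hF, fourier_coe_apply, smul_eq_mul]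
    congr 2
    have : (Real.pi : ℂ) ≠ 0 := by exact_mod_cast Real.pi_ne_zero
    push_cast
    field_simp
  simp only [e] at this
  exact this

theorem contDiff_comp_exp (f : SmoothB) : ContDiff ℝ ∞ fun θ : ℝ => f.1 (Circle.exp θ) :=
  (ContMDiff.comp (g := f.1) f.2 contMDiff_circleExp).contDiff

/-- A distribution is determined by its Fourier coefficients. -/
theorem BoundaryDistribution.eq_zero_of_monomialB (T : BoundaryDistribution)
    (hT : ∀ k, T.toLinearMap (monomialB k) = 0) (f : SmoothB) : T.toLinearMap f = 0 := by
  have hf := contDiff_comp_exp f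
  have hp : Function.Periodic (fun θ : ℝ => f.1 (Circle.exp θ)) (2 * Real.pi) := fun θ => by simp
  have h := T.hasSum_monomialB (m := id) (summable_coeff hf hp) f fun b => by
    have := hasSum_coeff hf hp (arg b)
    simp only [← coe_exp_zpow, Circle.exp_arg] at this
    exact this.tsum_eq.symm
  simp only [id, hT, mul_zero] at h
  exact h.unique hasSum_zero

/-! ### Double Fourier series and the Fubini theorem for distributions -/

/-- The `k`-th Fourier coefficient, as a distribution on the circle. -/
def coeffDistribution (k : ℤ) : BoundaryDistribution where
  toLinearMap :=
    { toFun := fun f => coeff k fun θ => f.1 (Circle.exp θ)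
      map_add' := fun f g => by
        have hc : ∀ f : SmoothB, Continuous fun θ : ℝ => f.1 (Circle.exp θ) * cexp (-(I * k * θ)) :=
          fun f => by
            have : Continuous f.1 := ContMDiff.continuous f.2
            fun_prop
        simp only [coeff, Submodule.coe_add, Pi.add_apply, add_mul]
        rw [intervalIntegral.integral_add ((hc f).intervalIntegrable _ _)
          ((hc g).intervalIntegrable _ _), smul_add]
      map_smul' := fun c f => by
        simp only [coeff, Submodule.coe_smul, Pi.smul_apply, smul_eq_mul, mul_assoc,
          intervalIntegral.integral_const_mul, RingHom.id_apply]
        rw [mul_smul_comm] }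
  bound := ⟨1, 0, fun f M hM => by
    rw [one_mul]
    exact norm_coeff_le k fun θ => by simpa using hM 0 le_rfl θ⟩

/-- The Fourier coefficient of a function of two angles with frequency `j` in the first and `k` in
the second variable. -/
def coeff₂ (j k : ℤ) (f : ℝ × ℝ → ℂ) : ℂ := coeff j fun x => coeff k fun y => f (x, y)

theorem coeff₂_comp_swap (j k : ℤ) {f : ℝ × ℝ → ℂ} (hf : Continuous f) :
    coeff₂ j k (f ∘ Prod.swap) = coeff₂ k j f := by
  have h := MeasureTheory.intervalIntegral_intervalIntegral_swap (a := 0) (b := 2 * Real.pi) (c := 0)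
    (d := 2 * Real.pi)
    (F := fun x y : ℝ => f (x, y) * (cexp (-(I * k * x)) * cexp (-(I * j * y)))) (by
      refine MeasureTheory.IntegrableOn.mono_set (t := Set.Icc 0 (2 * Real.pi) ×ˢ
        Set.Icc 0 (2 * Real.pi)) (ContinuousOn.integrableOn_compact
          (isCompact_Icc.prod isCompact_Icc) (Continuous.continuousOn (by
            unfold Function.uncurry; fun_prop))) ?_
      rw [Set.uIoc_of_le Real.two_pi_pos.le]
      exact Set.prod_mono Set.Ioc_subset_Icc_self Set.Ioc_subset_Icc_self)
  simp only [coeff₂, coeff, Function.comp, Prod.swap_prod_mk, smul_mul_assoc,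
    intervalIntegral.integral_smul, ← intervalIntegral.integral_mul_const, mul_assoc]
  simp only [mul_assoc] at h
  rw [← h]
  simp only [mul_comm (cexp (-(I * (k * _)))) (cexp (-(I * (j * _))))]

/-- Periodicity in both variables, with period `2 π`. -/
def Biperiodic (f : ℝ × ℝ → ℂ) : Prop :=
  (∀ x, Function.Periodic (fun y => f (x, y)) (2 * Real.pi)) ∧
    ∀ y, Function.Periodic (fun x => f (x, y)) (2 * Real.pi)

theorem Biperiodic.comp_swap {f : ℝ × ℝ → ℂ} (hp : Biperiodic f) : Biperiodic (f ∘ Prod.swap) :=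
  ⟨hp.2, hp.1⟩

theorem Biperiodic.partialSnd {f : ℝ × ℝ → ℂ} (hf : ContDiff ℝ ∞ f) (hp : Biperiodic f) (n : ℕ) :
    Biperiodic (partialSnd f n) := by
  have e : ∀ x y, PattersonSullivan.partialSnd f n (x, y) =
      iteratedDeriv n (fun y => f (x, y)) y := fun x y => by rw [iteratedDeriv_snd hf]
  constructor
  · intro x
    simp only [e]
    exact periodic_iteratedDeriv (hp.1 x) n
  · intro y x
    simp only [e]
    congr 1
    funext z
    exact hp.2 z x

theorem Biperiodic.exists_bound {f : ℝ × ℝ → ℂ} (hf : Continuous f) (hp : Biperiodic f) :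
    ∃ M, ∀ p, ‖f p‖ ≤ M := by
  obtain ⟨M, hM⟩ := (isCompact_Icc.prod isCompact_Icc :
    IsCompact (Set.Icc 0 (2 * Real.pi) ×ˢ Set.Icc 0 (2 * Real.pi))).exists_bound_of_continuousOn
      hf.continuousOn
  refine ⟨M, fun p => ?_⟩
  obtain ⟨x, hx, hx'⟩ := (hp.2 p.2).exists_mem_Ico₀ Real.two_pi_pos p.1
  obtain ⟨y, hy, hy'⟩ := (hp.1 x).exists_mem_Ico₀ Real.two_pi_pos p.2
  have e : f p = f (x, y) := hx'.trans hy'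
  rw [e]
  exact hM _ ⟨Set.Ico_subset_Icc_self hx, Set.Ico_subset_Icc_self hy⟩

theorem norm_coeff₂_le (j k : ℤ) {f : ℝ × ℝ → ℂ} {M : ℝ} (hM : ∀ p, ‖f p‖ ≤ M) :
    ‖coeff₂ j k f‖ ≤ M :=
  norm_coeff_le j fun _ => norm_coeff_le k fun _ => hM _

theorem coeff_const_mul (k : ℤ) (c : ℂ) (f : ℝ → ℂ) :
    coeff k (fun θ => c * f θ) = c * coeff k f := by
  simp only [coeff, mul_assoc, intervalIntegral.integral_const_mul]
  rw [mul_smul_comm]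

theorem coeff₂_partialSnd (j k : ℤ) {f : ℝ × ℝ → ℂ} (hf : ContDiff ℝ ∞ f) (hp : Biperiodic f)
    (n : ℕ) : coeff₂ j k (partialSnd f n) = (I * k) ^ n * coeff₂ j k f := by
  rw [coeff₂, coeff₂, ← coeff_const_mul]
  congr 1
  funext x
  have hs : ContDiff ℝ ∞ fun y => f (x, y) := hf.comp (contDiff_const.prodMk contDiff_id)
  rw [← coeff_iteratedDeriv k hs (hp.1 x) n, iteratedDeriv_snd hf n x]

/-- The double Fourier coefficients of a smooth biperiodic function decay rapidly in both
frequencies. -/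
theorem exists_coeff₂_decay {f : ℝ × ℝ → ℂ} (hf : ContDiff ℝ ∞ f) (hp : Biperiodic f) (n : ℕ) :
    ∃ M, ∀ j k : ℤ, ‖coeff₂ j k f‖ * ((1 + |(j : ℝ)|) ^ n * (1 + |(k : ℝ)|) ^ n) ≤ M := by
  have hdecay : ∀ g : ℝ × ℝ → ℂ, ContDiff ℝ ∞ g → Biperiodic g → ∃ M, ∀ j k : ℤ,
      ‖coeff₂ j k g‖ ≤ M ∧ |(k : ℝ)| ^ n * ‖coeff₂ j k g‖ ≤ M := by
    intro g hg hgp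
    obtain ⟨M₀, h₀⟩ := hgp.exists_bound hg.continuous
    obtain ⟨M₁, h₁⟩ := (hgp.partialSnd hg n).exists_bound (contDiff_partialSnd hg n).continuous
    refine ⟨max M₀ M₁, fun j k => ⟨(norm_coeff₂_le j k h₀).trans (le_max_left _ _), ?_⟩⟩
    have := norm_coeff₂_le j k h₁
    rw [coeff₂_partialSnd j k hg hgp, norm_mul, norm_pow, norm_mul, norm_I, one_mul,
      norm_intCast] at this
    exact this.trans (le_max_right _ _)
  have hsw : ContDiff ℝ ∞ (f ∘ Prod.swap) := hf.comp (contDiff_snd.prodMk contDiff_fst)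
  -- the derivative of order `n` in the first variable
  set h : ℝ × ℝ → ℂ := partialSnd (f ∘ Prod.swap) n ∘ Prod.swap with hh
  have hhs : ContDiff ℝ ∞ h :=
    (contDiff_partialSnd hsw n).comp (contDiff_snd.prodMk contDiff_fst)
  have hhp : Biperiodic h := (hp.comp_swap.partialSnd hsw n).comp_swap
  have hc : ∀ j k, coeff₂ j k h = (I * j) ^ n * coeff₂ j k f := by
    intro j k
    rw [hh, coeff₂_comp_swap j k (contDiff_partialSnd hsw n).continuous,
      coeff₂_partialSnd k j hsw hp.comp_swap, coeff₂_comp_swap k j hf.continuous]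
  obtain ⟨A, hA⟩ := hdecay f hf hp
  obtain ⟨B, hB⟩ := hdecay h hhs hhp
  refine ⟨(2 ^ (n - 1) * 2 ^ (n - 1)) * (2 * A + 2 * B), fun j k => ?_⟩
  obtain ⟨a₁, a₂⟩ := hA j k
  obtain ⟨b₁, b₂⟩ := hB j k
  rw [hc, norm_mul, norm_pow, norm_mul, norm_I, one_mul, norm_intCast] at b₁ b₂
  have hj := add_pow_le zero_le_one (abs_nonneg (j : ℝ)) n
  have hk := add_pow_le zero_le_one (abs_nonneg (k : ℝ)) n
  rw [one_pow] at hj hk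
  calc _ ≤ ‖coeff₂ j k f‖ * ((2 ^ (n - 1) * (1 + |(j : ℝ)| ^ n)) *
        (2 ^ (n - 1) * (1 + |(k : ℝ)| ^ n))) := by gcongr
    _ = (2 ^ (n - 1) * 2 ^ (n - 1)) * (‖coeff₂ j k f‖ + |(k : ℝ)| ^ n * ‖coeff₂ j k f‖ +
        |(j : ℝ)| ^ n * ‖coeff₂ j k f‖ +
          |(k : ℝ)| ^ n * (|(j : ℝ)| ^ n * ‖coeff₂ j k f‖)) := by ring
    _ ≤ _ := mul_le_mul_of_nonneg_left (by linarith) (by positivity)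

theorem summable_coeff₂ {f : ℝ × ℝ → ℂ} (hf : ContDiff ℝ ∞ f) (hp : Biperiodic f) (n : ℕ) :
    Summable fun q : ℤ × ℤ =>
      ‖coeff₂ q.2 q.1 f‖ * ((1 + |(q.2 : ℝ)|) ^ n * (1 + |(q.1 : ℝ)|) ^ n) := by
  obtain ⟨M, hM⟩ := exists_coeff₂_decay hf hp (n + 2)
  refine ((summable_inv_sq_int.mul_of_nonneg summable_inv_sq_int (fun k => by positivity)
    (fun k => by positivity)).mul_left M).of_nonneg_of_le (fun q => by positivity) fun q => ?_
  rw [← mul_inv, ← div_eq_mul_inv, le_div_iff₀ (by positivity)]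
  refine le_of_eq_of_le ?_ (hM q.2 q.1)
  ring

/-- The double Fourier expansion. The pairs are indexed as (frequency in the second variable,
frequency in the first), the order in which the iterated sum arises. -/
theorem SmoothFamily.coeff₂_hasSum {g : ℝ → Circle → ℂ} (hg : SmoothFamily g)
    (hp : Function.Periodic g (2 * Real.pi)) (x y : ℝ) :
    HasSum (fun q : ℤ × ℤ => coeff₂ q.2 q.1 (fun p => g p.1 (Circle.exp p.2)) *
      cexp (I * q.2 * x) * cexp (I * q.1 * y)) (g x (Circle.exp y)) := by
  have hp2 : Biperiodic fun p => g p.1 (Circle.exp p.2) :=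
    ⟨fun x y => by simp, fun y x => by simp only [hp x]⟩
  have hsum : Summable (fun q : ℤ × ℤ => coeff₂ q.2 q.1 (fun p => g p.1 (Circle.exp p.2)) *
      cexp (I * q.2 * x) * cexp (I * q.1 * y)) := by
    refine Summable.of_norm ?_
    simpa only [norm_mul, ← coe_exp_zpow, Circle.norm_coe, mul_one, pow_zero] using
      summable_coeff₂ hg hp2 0
  have h1 : ∀ k : ℤ, HasSum (fun j : ℤ => coeff₂ j k (fun p => g p.1 (Circle.exp p.2)) *
      cexp (I * j * x) * cexp (I * k * y))
        (coeff k (fun y => g x (Circle.exp y)) * cexp (I * k * y)) := fun k =>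
    (hasSum_coeff (hg.contDiff (coeffDistribution k))
      (fun x => by simp only [hp x]) x).mul_right _
  have h2 := hsum.hasSum.prod_fiberwise h1
  have h3 := hasSum_coeff (f := fun y => g x (Circle.exp y))
    (ContDiff.comp (g := fun p : ℝ × ℝ => g p.1 (Circle.exp p.2)) hg
      (contDiff_const.prodMk contDiff_id)) (fun y => by simp) y
  rw [← h2.unique h3]
  exact hsum.hasSum

/-- The iterated pairing of a distribution with a smooth function of two variables, in terms of
double Fourier coefficients. -/
theorem BoundaryDistribution.hasSum_iterated (T : BoundaryDistribution) {H : Circle → Circle → ℂ}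
    (hH : SmoothFamily fun x => H (Circle.exp x)) (Φ : SmoothB) (hmem : ∀ b', H b' ∈ SmoothB)
    (hΦ : ∀ b', Φ.1 b' = T.toLinearMap ⟨H b', hmem b'⟩) :
    HasSum (fun q : ℤ × ℤ => coeff₂ q.2 q.1 (fun p => H (Circle.exp p.1) (Circle.exp p.2)) *
      T.toLinearMap (monomialB q.1) * T.toLinearMap (monomialB q.2)) (T.toLinearMap Φ) := by
  have hp : Function.Periodic (fun x => H (Circle.exp x)) (2 * Real.pi) := fun x => by simp
  have hp2 : Biperiodic fun p => H (Circle.exp p.1) (Circle.exp p.2) :=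
    ⟨fun x y => by simp, fun y x => by simp⟩
  have hs := summable_coeff₂ hH hp2
  have h1 : ∀ b', HasSum (fun q : ℤ × ℤ =>
      coeff₂ q.2 q.1 (fun p => H (Circle.exp p.1) (Circle.exp p.2)) *
        (monomialB q.2).1 b' * T.toLinearMap (monomialB q.1)) (Φ.1 b') := by
    intro b'
    rw [hΦ]
    refine T.hasSum_monomialB (fun N => ?_) _ fun b => ?_
    · refine (hs N).of_nonneg_of_le (fun q => by positivity) fun q => ?_
      rw [norm_mul, monomialB, Circle.norm_coe, mul_one]
      refine mul_le_mul_of_nonneg_left ?_ (norm_nonneg _)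
      refine le_mul_of_one_le_left (by positivity) (one_le_pow₀ ?_)
      linarith [abs_nonneg (q.2 : ℝ)]
    · have := hH.coeff₂_hasSum hp (arg b') (arg b)
      simp only [← coe_exp_zpow, Circle.exp_arg] at this
      exact this.tsum_eq.symm
  obtain ⟨C, N₀, hC⟩ := T.norm_monomialB_le
  refine T.hasSum_monomialB (fun N => ?_) Φ fun b' => ?_
  · refine ((hs (N + N₀)).mul_left C).of_nonneg_of_le (fun q => by positivity) fun q => ?_
    have h₁ : (1 : ℝ) ≤ 1 + |(q.1 : ℝ)| := by linarith [abs_nonneg (q.1 : ℝ)]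
    have h₂ : (1 : ℝ) ≤ 1 + |(q.2 : ℝ)| := by linarith [abs_nonneg (q.2 : ℝ)]
    have hC0 : 0 ≤ C := by simpa using (norm_nonneg _).trans (hC 0)
    have h₃ : ‖T.toLinearMap (monomialB q.1)‖ ≤ C * (1 + |(q.1 : ℝ)|) ^ (N + N₀) :=
      (hC q.1).trans (by gcongr; omega)
    rw [norm_mul]
    calc _ ≤ ‖coeff₂ q.2 q.1 (fun p => H (Circle.exp p.1) (Circle.exp p.2))‖ *
          (C * (1 + |(q.1 : ℝ)|) ^ (N + N₀)) * (1 + |(q.2 : ℝ)|) ^ (N + N₀) := by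
          gcongr; omega
      _ = _ := by ring
  · rw [← (h1 b').tsum_eq]
    exact tsum_congr fun q => by ring

/-- Fubini's theorem: the iterated pairing of `T ⊗ T` with a smooth function on the torus does not
depend on the order of the variables. -/
theorem BoundaryDistribution.iterated_comm (T : BoundaryDistribution) {H : Circle → Circle → ℂ}
    (hH : SmoothFamily fun x => H (Circle.exp x)) (Φ Ψ : SmoothB)
    (h₁ : ∀ b', H b' ∈ SmoothB) (hΦ : ∀ b', Φ.1 b' = T.toLinearMap ⟨H b', h₁ b'⟩)
    (h₂ : ∀ b, (fun b' => H b' b) ∈ SmoothB)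
    (hΨ : ∀ b, Ψ.1 b = T.toLinearMap ⟨fun b' => H b' b, h₂ b⟩) :
    T.toLinearMap Φ = T.toLinearMap Ψ := by
  have e₁ := T.hasSum_iterated hH Φ h₁ hΦ
  have e₂ := T.hasSum_iterated (H := fun b b' => H b' b)
    (ContDiff.comp (g := fun p : ℝ × ℝ => H (Circle.exp p.1) (Circle.exp p.2)) hH
      (contDiff_snd.prodMk contDiff_fst)) Ψ h₂ hΨ
  refine e₁.unique ((Equiv.prodComm ℤ ℤ).hasSum_iff.1 ?_)
  convert e₂ using 1
  funext q
  have := coeff₂_comp_swap q.2 q.1 (ContDiff.continuous hH)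
  simp only [Function.comp_def, Equiv.prodComm_apply, Prod.fst_swap, Prod.snd_swap] at this ⊢
  rw [this]
  ring

/-- Time reversal invariance holds for every distribution `T`: the kernel is symmetric. -/
theorem psDistribution_isTimeReversalInvariant (r : ℂ) (T : BoundaryDistribution) :
    (psDistribution r T).IsTimeReversalInvariant := by
  intro F
  have hk : ∀ b b' : Circle, psKernel r b b' = psKernel r b' b := fun b b' => by
    rw [psKernel, psKernel, norm_sub_rev]
  have hmem : ∀ b, (fun b' => F.1 (b', b) * psKernel r b' b) ∈ SmoothB := fun b => by
    have := OffDiagTest.slice_mem r (OffDiagTest.swap F) b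
    simpa only [OffDiagTest.swap, hk b] using this
  refine (T.iterated_comm (H := fun b' b => F.1 (b', b) * psKernel r b' b)
    (OffDiagTest.mul_contDiff r F) (OffDiagTest.psInner r T F)
    (OffDiagTest.psInner r T (OffDiagTest.swap F)) (OffDiagTest.slice_mem r F) (fun _ => rfl)
    hmem fun b => ?_).symm
  refine congrArg T.toLinearMap (Subtype.ext (funext fun b' => ?_))
  simp only [OffDiagTest.slice, OffDiagTest.swap, hk b]

/-! ### Injectivity of the Poisson transform -/

theorem multichoose_ne_zero {s : ℂ} (hs : ∀ n : ℕ, s ≠ -(n : ℂ)) (n : ℕ) :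
    Ring.multichoose s n ≠ 0 := by
  intro h
  have h1 := Ring.factorial_nsmul_multichoose_eq_ascPochhammer s n
  rw [h, smul_zero, Polynomial.ascPochhammer_smeval_eq_eval] at h1
  obtain ⟨k, -, hk⟩ := (ascPochhammer_eval_eq_zero_iff n s).1 h1.symm
  exact hs k (by linear_combination hk)

theorem hasFPowerSeriesOnBall_multichoose (s : ℂ) :
    HasFPowerSeriesOnBall (fun x : ℂ => 1 / (1 - x) ^ s)
      (.ofScalars ℂ (Ring.multichoose s)) 0 1 := by
  simpa only [← Ring.multichoose_eq] using one_div_one_sub_cpow_hasFPowerSeriesOnBall_zero s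

theorem hasSum_multichoose (s : ℂ) {w : ℂ} (hw : ‖w‖ < 1) :
    HasSum (fun n => Ring.multichoose s n * w ^ n) (1 / (1 - w) ^ s) := by
  have h := (hasFPowerSeriesOnBall_multichoose s).hasSum (y := w) (by
    rw [Metric.mem_eball, edist_zero_right, ← ofReal_norm]
    exact ENNReal.ofReal_lt_one.2 hw)
  simpa [FormalMultilinearSeries.ofScalars_apply_eq, mul_comm] using h

theorem summable_multichoose (s : ℂ) {ρ : ℝ} (h0 : 0 ≤ ρ) (h1 : ρ < 1) (N : ℕ) :
    Summable fun n : ℕ => ‖Ring.multichoose s n‖ * ρ ^ n * (1 + (n : ℝ)) ^ N := by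
  obtain ⟨σ, hσ, hσ1⟩ := exists_between h1
  have hσ0 : 0 < σ := h0.trans_lt hσ
  obtain ⟨C, hC, hb⟩ := FormalMultilinearSeries.norm_mul_pow_le_of_lt_radius
    (.ofScalars ℂ (Ring.multichoose s)) (r := ⟨σ, hσ0.le⟩)
    (lt_of_lt_of_le (ENNReal.coe_lt_one_iff.2 hσ1) (hasFPowerSeriesOnBall_multichoose s).r_le)
  have hq : ‖ρ / σ‖ < 1 := by
    rw [Real.norm_of_nonneg (by positivity), div_lt_one hσ0]
    exact hσ
  have hS := (((summable_pow_mul_geometric_of_norm_lt_one 0 hq).add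
    (summable_pow_mul_geometric_of_norm_lt_one N hq)).mul_left (C * 2 ^ (N - 1)))
  refine hS.of_nonneg_of_le (fun n => by positivity) fun n => ?_
  have hn := add_pow_le zero_le_one (Nat.cast_nonneg n : (0 : ℝ) ≤ n) N
  rw [one_pow] at hn
  have hbn := hb n
  rw [FormalMultilinearSeries.ofScalars_norm] at hbn
  change ‖Ring.multichoose s n‖ * σ ^ n ≤ C at hbn
  have e : ρ ^ n = σ ^ n * (ρ / σ) ^ n := by rw [← mul_pow, mul_div_cancel₀ _ hσ0.ne']
  rw [e]
  calc _ = (‖Ring.multichoose s n‖ * σ ^ n) * (ρ / σ) ^ n * (1 + (n : ℝ)) ^ N := by ring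
    _ ≤ C * (ρ / σ) ^ n * (2 ^ (N - 1) * (1 + (n : ℝ) ^ N)) := by gcongr
    _ = _ := by ring

/-- Principal branches cause no trouble here, since the arguments of `x` and `conj x` cancel. -/
theorem norm_sq_cpow {x : ℂ} (hx : 0 < x.re) (s : ℂ) :
    ((‖x‖ ^ 2 : ℝ) : ℂ) ^ s = x ^ s * conj x ^ s := by
  have hx0 : x ≠ 0 := fun h => by simp [h] at hx
  have hc0 : conj x ≠ 0 := (map_ne_zero _).2 hx0
  have harg : x.arg ≠ Real.pi := fun h => by
    rw [arg_eq_pi_iff] at h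
    linarith [h.1]
  have hn : ‖x‖ ^ 2 ≠ 0 := by positivity
  rw [cpow_def_of_ne_zero hx0, cpow_def_of_ne_zero hc0,
    cpow_def_of_ne_zero (ofReal_ne_zero.2 hn), ← Complex.exp_add, log_conj _ harg, ← add_mul,
    add_conj, log_re, ← ofReal_log (by positivity), Real.log_pow]
  norm_cast

theorem poissonWave_eq (r : ℂ) (z : 𝔻) (b : Circle) :
    poissonWave r z b = ((1 - ‖(z : ℂ)‖ ^ 2 : ℝ) : ℂ) ^ (1 / 2 + I * r) *
      (1 / (1 - z * conj (b : ℂ)) ^ (1 / 2 + I * r) *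
        (1 / (1 - conj (z : ℂ) * b) ^ (1 / 2 + I * r))) := by
  have hre : 0 < (1 - z * conj (b : ℂ)).re := by
    have hwn : ‖z * conj (b : ℂ)‖ < 1 := by
      rw [norm_mul, norm_conj, Circle.norm_coe, mul_one]
      exact z.norm_lt_one
    rw [sub_re, one_re, sub_pos]
    exact (re_le_norm _).trans_lt hwn
  have hb : (b : ℂ) * conj (b : ℂ) = 1 := by rw [mul_conj]; simp
  have hnorm : ‖(z : ℂ) - b‖ = ‖1 - z * conj (b : ℂ)‖ := by
    have : (z : ℂ) - b = -(b * (1 - z * conj (b : ℂ))) := by linear_combination -(z : ℂ) * hb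
    rw [this, norm_neg, norm_mul, Circle.norm_coe, one_mul]
  have hz : 0 ≤ 1 - ‖(z : ℂ)‖ ^ 2 := by linarith [z.sq_norm_lt_one]
  have hi : 0 ≤ (‖1 - z * conj (b : ℂ)‖ ^ 2)⁻¹ := by positivity
  have harg : arg ((‖1 - z * conj (b : ℂ)‖ ^ 2 : ℝ) : ℂ) ≠ Real.pi := by
    rw [arg_ofReal_of_nonneg (by positivity)]
    exact Real.pi_pos.ne
  rw [poissonWave, hnorm, div_eq_mul_inv, ofReal_mul, mul_cpow_ofReal_nonneg hz hi, ofReal_inv,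
    inv_cpow _ _ harg, norm_sq_cpow hre]
  simp only [map_sub, map_one, map_mul, conj_conj, one_div, mul_inv]

theorem hasSum_mul_mul {f g : ℕ → ℂ} {a b : ℂ} (c : ℂ) (hf : HasSum f a) (hg : HasSum g b) :
    HasSum (fun q : ℕ × ℕ => c * (f q.1 * g q.2)) (c * (a * b)) :=
  (hf.mul hg (summable_mul_of_summable_norm hf.summable.norm hg.summable.norm)).mul_left c

/-- The expansion of the plane wave into monomials: the factor `|z - b| ^ (-2 s)` is
`(1 - z / b) ^ (-s) (1 - conj z * b) ^ (-s)`, and each factor is a binomial series. -/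
theorem poissonWave_hasSum (r : ℂ) (z : 𝔻) (b : Circle) :
    HasSum (fun q : ℕ × ℕ => ((1 - ‖(z : ℂ)‖ ^ 2 : ℝ) : ℂ) ^ (1 / 2 + I * r) *
      (Ring.multichoose (1 / 2 + I * r) q.1 * Ring.multichoose (1 / 2 + I * r) q.2 *
        ((z : ℂ) ^ q.1 * conj (z : ℂ) ^ q.2)) * (monomialB ((q.2 : ℤ) - q.1)).1 b)
      (poissonWave r z b) := by
  have h1 := hasSum_multichoose (1 / 2 + I * r) (w := z * conj (b : ℂ)) (by
    rw [norm_mul, norm_conj, Circle.norm_coe, mul_one]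
    exact z.norm_lt_one)
  have h2 := hasSum_multichoose (1 / 2 + I * r) (w := conj (z : ℂ) * b) (by
    rw [norm_mul, norm_conj, Circle.norm_coe, mul_one]
    exact z.norm_lt_one)
  have h := hasSum_mul_mul (((1 - ‖(z : ℂ)‖ ^ 2 : ℝ) : ℂ) ^ (1 / 2 + I * r)) h1 h2
  rw [poissonWave_eq]
  refine (congrArg (fun g => HasSum g _) (funext fun q => ?_)).mpr h
  have hbb : ((b ^ ((q.2 : ℤ) - q.1) : Circle) : ℂ) = (b : ℂ) ^ q.2 * conj (b : ℂ) ^ q.1 := by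
    rw [_root_.zpow_sub, ← Circle.coe_inv_eq_conj, zpow_natCast, zpow_natCast]
    push_cast
    rw [inv_pow]
  simp only [monomialB, hbb, mul_pow]
  ring

theorem summable_poissonWave (r : ℂ) (z : 𝔻) (N : ℕ) :
    Summable fun q : ℕ × ℕ => ‖((1 - ‖(z : ℂ)‖ ^ 2 : ℝ) : ℂ) ^ (1 / 2 + I * r) *
      (Ring.multichoose (1 / 2 + I * r) q.1 * Ring.multichoose (1 / 2 + I * r) q.2 *
        ((z : ℂ) ^ q.1 * conj (z : ℂ) ^ q.2))‖ * (1 + |(((q.2 : ℤ) - q.1 : ℤ) : ℝ)|) ^ N := by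
  have h := summable_multichoose (1 / 2 + I * r) (norm_nonneg (z : ℂ)) z.norm_lt_one N
  refine ((h.mul_of_nonneg h (fun n => by positivity) fun n => by positivity).mul_left
    ‖((1 - ‖(z : ℂ)‖ ^ 2 : ℝ) : ℂ) ^ (1 / 2 + I * r)‖).of_nonneg_of_le
      (fun q => by positivity) fun q => ?_
  have hle : (1 + |(((q.2 : ℤ) - q.1 : ℤ) : ℝ)|) ≤ (1 + (q.1 : ℝ)) * (1 + (q.2 : ℝ)) := by
    have h1 : |(((q.2 : ℤ) - q.1 : ℤ) : ℝ)| ≤ q.1 + q.2 := by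
      push_cast
      rw [abs_le]
      constructor <;> linarith [(Nat.cast_nonneg q.1 : (0 : ℝ) ≤ q.1),
        (Nat.cast_nonneg q.2 : (0 : ℝ) ≤ q.2)]
    have : (0 : ℝ) ≤ q.1 * q.2 := by positivity
    linarith
  simp only [norm_mul, norm_pow, norm_conj]
  calc _ ≤ _ * ((1 + (q.1 : ℝ)) * (1 + (q.2 : ℝ))) ^ N := by gcongr
    _ = _ := by rw [mul_pow]; ring

/-- The coefficients of a convergent power series vanish if its sum vanishes for real arguments. -/
theorem eq_zero_of_hasSum_pow {B : ℕ → ℂ}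
    (h : ∀ ρ : ℝ, |ρ| < 1 → HasSum (fun n => (ρ : ℂ) ^ n * B n) 0) (n : ℕ) : B n = 0 := by
  set p : FormalMultilinearSeries ℝ ℝ ℂ :=
    fun n => ContinuousMultilinearMap.mkPiRing ℝ (Fin n) (B n) with hp
  have hp' : HasFPowerSeriesOnBall 0 p 0 ((1 / 2 : NNReal) : ENNReal) := by
    refine ⟨?_, by simp, fun {y} hy => ?_⟩
    · refine p.le_radius_of_summable_norm ?_
      have := (h (1 / 2) (by norm_num [abs_lt])).summable.norm
      refine this.congr fun n => ?_
      simp [hp, mul_comm]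
    · rw [Metric.mem_eball, edist_zero_right, ← ofReal_norm] at hy
      have hy' : |y| < 1 := by
        have : ‖y‖ < 1 / 2 := by
          rw [ENNReal.ofReal_lt_coe_iff (norm_nonneg _)] at hy
          simpa using hy
        rw [Real.norm_eq_abs] at this
        linarith
      simpa [hp] using h y hy'
  have := hp'.hasFPowerSeriesAt.apply_eq_zero n 1
  simpa [hp] using this

/-- If all plane waves are annihilated by `T`, then, at `z = ρ u` with `|u| = 1`, the coefficient of
`ρ ^ n` in the expansion of the wave is annihilated as well. -/
theorem sum_antidiagonal_eq_zero {r : ℂ} {T : BoundaryDistribution}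
    (hT : ∀ z : 𝔻, T.toLinearMap ⟨poissonWave r z, poissonWave_mem r z⟩ = 0) (u : Circle) (n : ℕ) :
    ∑ q ∈ Finset.HasAntidiagonal.antidiagonal n,
      Ring.multichoose (1 / 2 + I * r) q.1 * Ring.multichoose (1 / 2 + I * r) q.2 *
        ((u : ℂ) ^ q.1 * conj (u : ℂ) ^ q.2) *
          T.toLinearMap (monomialB ((q.2 : ℤ) - q.1)) = 0 := by
  refine eq_zero_of_hasSum_pow (B := fun n => ∑ q ∈ Finset.HasAntidiagonal.antidiagonal n,
    Ring.multichoose (1 / 2 + I * r) q.1 * Ring.multichoose (1 / 2 + I * r) q.2 *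
      ((u : ℂ) ^ q.1 * conj (u : ℂ) ^ q.2) * T.toLinearMap (monomialB ((q.2 : ℤ) - q.1)))
    (fun ρ hρ => ?_) n
  let z : 𝔻 := UnitDisc.mk (ρ * u) (by
    simpa only [norm_mul, Circle.norm_coe, mul_one, norm_real, Real.norm_eq_abs] using hρ)
  have hz : (z : ℂ) = ρ * u := rfl
  have h := T.hasSum_monomialB (summable_poissonWave r z) ⟨poissonWave r z, poissonWave_mem r z⟩
    fun b => (poissonWave_hasSum r z b).tsum_eq.symm
  have hK : ((1 - ‖(z : ℂ)‖ ^ 2 : ℝ) : ℂ) ^ (1 / 2 + I * r) ≠ 0 := by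
    rw [Ne, cpow_eq_zero_iff, ofReal_eq_zero]
    exact fun h => (sub_pos.2 z.sq_norm_lt_one).ne' h.1
  simp only [hT, mul_assoc] at h
  have h2 := h.mul_left (((1 - ‖(z : ℂ)‖ ^ 2 : ℝ) : ℂ) ^ (1 / 2 + I * r))⁻¹
  simp only [inv_mul_cancel_left₀ hK, mul_zero] at h2
  have h3 := ((Finset.HasAntidiagonal.sigmaAntidiagonalEquivProd (A := ℕ)).hasSum_iff.2 h2).sigma
    (fun n => hasSum_fintype _)
  -- each term of degree `n` carries the factor `ρ ^ n`
  refine (congrArg (fun g => HasSum g _) (funext fun n => ?_)).mpr h3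
  rw [Finset.mul_sum, ← Finset.sum_coe_sort]
  refine Finset.sum_congr rfl fun q _ => ?_
  have hq : (q : ℕ × ℕ).1 + (q : ℕ × ℕ).2 = n := Finset.HasAntidiagonal.mem_antidiagonal.1 q.2
  simp only [Function.comp, Finset.HasAntidiagonal.sigmaAntidiagonalEquivProd_apply, hz,
    map_mul, conj_ofReal]
  have hpow : (ρ : ℂ) ^ n = (ρ : ℂ) ^ (q : ℕ × ℕ).1 * (ρ : ℂ) ^ (q : ℕ × ℕ).2 := by
    rw [← pow_add, hq]
  rw [hpow, mul_pow, mul_pow]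
  ring

/-- The Poisson transform is injective on distributions when `1 / 2 + i r` is not a non-positive
integer. -/
theorem BoundaryDistribution.eq_zero_of_poissonWave {r : ℂ}
    (hr : ∀ n : ℕ, 1 / 2 + I * r ≠ -(n : ℂ)) (T : BoundaryDistribution)
    (hT : ∀ z : 𝔻, T.toLinearMap ⟨poissonWave r z, poissonWave_mem r z⟩ = 0) (f : SmoothB) :
    T.toLinearMap f = 0 := by
  have key : ∀ n : ℕ, T.toLinearMap (monomialB n) = 0 ∧ T.toLinearMap (monomialB (-n)) = 0 := by
    intro n
    induction n using Nat.strong_induction_on with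
    | _ n ih =>
    rcases Nat.eq_zero_or_pos n with rfl | hn
    · have := sum_antidiagonal_eq_zero hT 1 0
      simpa [Ring.multichoose_zero_right] using this
    · have hlow : ∀ k : ℤ, k.natAbs < n → T.toLinearMap (monomialB k) = 0 := by
        intro k hk
        rcases Int.natAbs_eq k with h | h <;> rw [h]
        exacts [(ih _ hk).1, (ih _ hk).2]
      have hu : ∀ u : Circle, (u : ℂ) ^ n * T.toLinearMap (monomialB (-n)) +
          conj (u : ℂ) ^ n * T.toLinearMap (monomialB n) = 0 := by
        intro u
        have h := sum_antidiagonal_eq_zero hT u n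
        rw [← Finset.sum_subset (s₁ := {(n, 0), (0, n)}) (by
          intro q hq
          simp only [Finset.mem_insert, Finset.mem_singleton] at hq
          rcases hq with rfl | rfl <;> simp) (by
          intro q hq hq'
          rw [Finset.HasAntidiagonal.mem_antidiagonal] at hq
          -- the other pairs have `|q.2 - q.1| < n`, so the induction hypothesis applies
          have h1 : q.1 ≠ 0 := fun h => hq' (by
            simp [Prod.ext_iff, h, (by omega : q.2 = n)])
          have h2 : q.2 ≠ 0 := fun h => hq' (by
            simp [Prod.ext_iff, h, (by omega : q.1 = n)])
          rw [hlow _ (by omega), mul_zero]),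
          Finset.sum_pair (by simp [Prod.ext_iff, hn.ne'])] at h
        simp only [Ring.multichoose_zero_right, pow_zero, mul_one, one_mul, Nat.cast_zero,
          zero_sub, sub_zero, mul_assoc, ← mul_add] at h
        exact (mul_eq_zero.1 h).resolve_left (multichoose_ne_zero hr n)
      have h1 := hu 1
      -- `u ^ n = i` separates the two coefficients
      have h2 := hu (Circle.exp (Real.pi / 2 / n))
      have hI : ((Circle.exp (Real.pi / 2 / n) : Circle) : ℂ) ^ n = I := by
        have hn0 : (n : ℂ) ≠ 0 := by exact_mod_cast hn.ne'
        rw [Circle.coe_exp, ← Complex.exp_nat_mul]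
        push_cast
        have e : (n : ℂ) * (Real.pi / 2 / n * I) = Real.pi / 2 * I := by field_simp
        rw [e, exp_pi_div_two_mul_I]
      rw [← map_pow, hI, conj_I] at h2
      simp only [Circle.coe_one, one_pow, map_one, one_mul] at h1
      constructor
      · linear_combination (1 / 2) * h1 + (I / 2) * h2 - (1 / 2) *
          (T.toLinearMap (monomialB (-n)) - T.toLinearMap (monomialB n)) * I_sq
      · linear_combination (1 / 2) * h1 - (I / 2) * h2 + (1 / 2) *
          (T.toLinearMap (monomialB (-n)) - T.toLinearMap (monomialB n)) * I_sq
  refine T.eq_zero_of_monomialB (fun k => ?_) f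
  rcases Int.natAbs_eq k with h | h <;> rw [h]
  exacts [(key _).1, (key _).2]

/-! ### Conformal action on the disc and its boundary -/

theorem conj_div_self {v : ℂ} (hv : v ≠ 0) : conj v / v = cexp (-(2 * arg v) * I) := by
  have hn : (‖v‖ : ℂ) ≠ 0 := by simpa using hv
  have h := norm_mul_exp_arg_mul_I v
  have hc : conj v = ‖v‖ * cexp (-(arg v * I)) := by
    conv_lhs => rw [← h]
    rw [map_mul, conj_ofReal, ← exp_conj, map_mul, conj_ofReal, conj_I, mul_neg]
  rw [hc]
  nth_rewrite 3 [← h]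
  rw [mul_div_mul_left _ _ hn, ← Complex.exp_sub]
  congr 1
  ring

/-- The boundary action lifts to a smooth map of the angle: with `d = conj β b + conj α` one has
`g b = b * (conj d / d)`, and `d / conj α` stays in the right half plane, so that its argument is
smooth. -/
theorem SU11.exists_angle_lift (g : SU11) :
    ∃ h : ℝ → ℝ, ContDiff ℝ ∞ h ∧ ∀ θ, circleMap g (Circle.exp θ) = Circle.exp (h θ) := by
  have hab := normSq_sub g
  set α := g.1 0 0 with hα
  set β := g.1 0 1 with hβ
  have hα0 : conj α ≠ 0 := by
    rw [Ne, map_eq_zero]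
    intro h
    rw [h, map_zero] at hab
    linarith [normSq_nonneg β]
  set κ := conj β / conj α with hκ
  have hκ1 : ‖κ‖ < 1 := by
    rw [hκ, norm_div, norm_conj, norm_conj, div_lt_one (by simpa using hα0)]
    apply lt_of_pow_lt_pow_left₀ 2 (norm_nonneg _)
    rw [← normSq_eq_norm_sq, ← normSq_eq_norm_sq]
    linarith
  have hs : ∀ θ : ℝ, 1 + κ * cexp (θ * I) ∈ slitPlane := fun θ => by
    refine mem_slitPlane_of_norm_lt_one ?_
    rwa [norm_mul, norm_exp_ofReal_mul_I, mul_one]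
  refine ⟨fun θ => θ - 2 * arg (conj α) - 2 * (log (1 + κ * cexp (θ * I))).im, ?_, fun θ => ?_⟩
  · have h1 : ContDiff ℝ ∞ fun θ : ℝ => 1 + κ * cexp (θ * I) :=
      contDiff_const.add (contDiff_const.mul (ofRealCLM.contDiff.mul contDiff_const).cexp)
    have h2 : ContDiff ℝ ∞ fun θ : ℝ => log (1 + κ * cexp (θ * I)) :=
      contDiff_iff_contDiffAt.2 fun θ => ContDiffAt.comp (g := log)
        (f := fun θ : ℝ => 1 + κ * cexp (θ * I)) θ
        ((contDiffAt_log (hs θ)).restrict_scalars ℝ) h1.contDiffAt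
    exact (contDiff_id.sub contDiff_const).sub (contDiff_const.mul (imCLM.contDiff.comp h2))
  · apply Circle.ext
    have hv : 1 + κ * cexp (θ * I) ≠ 0 := slitPlane_ne_zero (hs θ)
    have e1 : (circleMap g (Circle.exp θ) : ℂ) =
        cexp (θ * I) * (conj (conj α) / conj α) *
          (conj (1 + κ * cexp (θ * I)) / (1 + κ * cexp (θ * I))) := by
      change mobius g (Circle.exp θ) = _
      rw [mobius_eq, Circle.coe_exp, ← hα, ← hβ]
      have hee : cexp (θ * I) * conj (cexp (θ * I)) = 1 := by
        rw [mul_conj, normSq_eq_norm_sq, norm_exp_ofReal_mul_I]; simp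
      have hd : conj β * cexp (θ * I) + conj α = conj α * (1 + κ * cexp (θ * I)) := by
        rw [hκ]; field_simp; ring
      have hn : α * cexp (θ * I) + β =
          cexp (θ * I) * conj (conj α * (1 + κ * cexp (θ * I))) := by
        rw [← hd]
        simp only [map_add, map_mul, conj_conj]
        linear_combination -β * hee
      rw [hd, hn, map_mul]
      field_simp
    rw [e1, conj_div_self hα0, conj_div_self hv, Circle.coe_exp, ← Complex.exp_add,
      ← Complex.exp_add]
    congr 1
    simp only [log_im]
    push_cast
    ring

/-- The denominator `conj β z + conj α` of the Moebius transformation; the conformal factor at `z`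
is `‖denom g z‖ ^ (-2)`. -/
def SU11.denom (g : SU11) (z : ℂ) : ℂ := conj (g.1 0 1) * z + conj (g.1 0 0)

theorem SU11.mobius_sub_mobius (g : SU11) {z w : ℂ} (hz : normSq z ≤ 1) (hw : normSq w ≤ 1) :
    mobius g z - mobius g w = (z - w) / (denom g z * denom g w) := by
  have h1 := denom_ne_zero g hz
  have h2 := denom_ne_zero g hw
  have h : g.1 0 0 * conj (g.1 0 0) - g.1 0 1 * conj (g.1 0 1) = 1 := by
    rw [mul_conj, mul_conj, ← ofReal_sub, normSq_sub, ofReal_one]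
  rw [mobius_eq, mobius_eq, div_sub_div _ _ h1 h2, denom, denom]
  congr 1
  linear_combination (z - w) * h

theorem SU11.one_sub_norm_mobius_sq (g : SU11) {z : ℂ} (hz : normSq z ≤ 1) :
    1 - ‖mobius g z‖ ^ 2 = (1 - ‖z‖ ^ 2) / ‖denom g z‖ ^ 2 := by
  have h1 := denom_ne_zero g hz
  have h2 : ‖denom g z‖ ≠ 0 := norm_ne_zero_iff.2 h1
  have h := normSq_denom g z
  change normSq (denom g z) = _ at h
  rw [normSq_eq_norm_sq, normSq_eq_norm_sq, normSq_eq_norm_sq] at h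
  rw [mobius_eq]
  change 1 - ‖_ / denom g z‖ ^ 2 = _
  rw [norm_div]
  field_simp
  linarith

theorem SU11.discMap_discMap_inv (g : SU11) (z : 𝔻) : discMap g (discMap g⁻¹ z) = z := by
  apply UnitDisc.coe_injective
  change mobius g (mobius g⁻¹ z) = z
  have hz : conj ((g⁻¹ : SU11).1 0 1) * (z : ℂ) + conj ((g⁻¹ : SU11).1 0 0) ≠ 0 :=
    denom_ne_zero _ z.normSq_lt_one.le
  have h : g.1 0 0 * conj (g.1 0 0) - g.1 0 1 * conj (g.1 0 1) = 1 := by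
    rw [mul_conj, mul_conj, ← ofReal_sub, normSq_sub, ofReal_one]
  have e0 : (g⁻¹ : SU11).1 0 0 = conj (g.1 0 0) := by
    rw [← g.2.2]; simp [Matrix.SpecialLinearGroup.coe_inv, Matrix.adjugate_fin_two]
  have e1 : (g⁻¹ : SU11).1 0 1 = -g.1 0 1 := by
    simp [Matrix.SpecialLinearGroup.coe_inv, Matrix.adjugate_fin_two]
  rw [mobius_eq g⁻¹]
  rw [e0, e1, map_neg, conj_conj] at hz ⊢
  rw [mobius_eq, mul_div_assoc', mul_div_assoc', div_add' _ _ _ hz, div_add' _ _ _ hz,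
    div_div_div_cancel_right₀ hz]
  have hd : conj (g.1 0 1) * (conj (g.1 0 0) * (z : ℂ) + -g.1 0 1) +
      conj (g.1 0 0) * (-conj (g.1 0 1) * z + g.1 0 0) = 1 := by linear_combination h
  rw [hd, div_one]
  linear_combination (z : ℂ) * h

/-- The Poisson kernel transforms by the conformal factor of the boundary action. -/
theorem poissonWave_discMap (r : ℂ) (g : SU11) (z : 𝔻) (b : Circle) :
    poissonWave r (SU11.discMap g z) (SU11.circleMap g b) *
      (((‖SU11.denom g b‖ ^ 2)⁻¹ : ℝ) : ℂ) ^ (1 / 2 + I * r) = poissonWave r z b := by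
  have hz := z.normSq_lt_one.le
  have hb : normSq (b : ℂ) ≤ 1 := by simp
  have h1 : ‖SU11.denom g z‖ ≠ 0 := norm_ne_zero_iff.2 (SU11.denom_ne_zero g hz)
  have h2 : ‖SU11.denom g b‖ ≠ 0 := norm_ne_zero_iff.2 (SU11.denom_ne_zero g hb)
  have h3 := (SU11.discMap g z).sq_norm_lt_one
  rw [poissonWave, poissonWave, ← mul_cpow_ofReal_nonneg
    (div_nonneg (by linarith) (by positivity)) (by positivity), ← ofReal_mul]
  congr 2
  change (1 - ‖SU11.mobius g z‖ ^ 2) / ‖SU11.mobius g z - SU11.mobius g b‖ ^ 2 * _ = _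
  rw [SU11.one_sub_norm_mobius_sq g hz, SU11.mobius_sub_mobius g hz hb, norm_div, norm_mul]
  field_simp

/-- The conformal weight of `g` on the boundary is the plane wave at `g⁻¹ 0`; in particular it is
smooth. -/
theorem poissonWave_discMap_inv_zero (r : ℂ) (g : SU11) (b : Circle) :
    poissonWave r (SU11.discMap g⁻¹ 0) b =
      (((‖SU11.denom g b‖ ^ 2)⁻¹ : ℝ) : ℂ) ^ (1 / 2 + I * r) := by
  have h1 : poissonWave r 0 (SU11.circleMap g b) = 1 := by
    rw [poissonWave, UnitDisc.coe_zero, zero_sub, norm_neg, norm_zero, Circle.norm_coe]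
    simp
  rw [← poissonWave_discMap r g, SU11.discMap_discMap_inv, h1, one_mul]

theorem ofReal_cpow_two_mul {x : ℝ} (hx : 0 < x) (s : ℂ) :
    (x : ℂ) ^ (2 * s) = ((x ^ 2 : ℝ) : ℂ) ^ s := by
  rw [cpow_def_of_ne_zero (ofReal_ne_zero.2 hx.ne'),
    cpow_def_of_ne_zero (ofReal_ne_zero.2 (by positivity)), ← ofReal_log hx.le,
    ← ofReal_log (by positivity), Real.log_pow]
  push_cast
  ring_nf

theorem psKernel_circleMap (r : ℂ) (g : SU11) (b' b : Circle) :
    psKernel r (SU11.circleMap g b') (SU11.circleMap g b) *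
      (poissonWave r (SU11.discMap g⁻¹ 0) b' * poissonWave r (SU11.discMap g⁻¹ 0) b) =
        psKernel r b' b := by
  have hb : ∀ b : Circle, normSq (b : ℂ) ≤ 1 := fun b => by simp
  have h : ∀ b : Circle, 0 < ‖SU11.denom g b‖⁻¹ := fun b =>
    inv_pos.2 (norm_pos_iff.2 (SU11.denom_ne_zero g (hb b)))
  have e : ∀ b : Circle, poissonWave r (SU11.discMap g⁻¹ 0) b =
      ((‖SU11.denom g b‖⁻¹ : ℝ) : ℂ) ^ (2 * (1 / 2 + I * r)) := fun b => by
    rw [poissonWave_discMap_inv_zero, ofReal_cpow_two_mul (h b), inv_pow]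
  have e2 : ‖(SU11.circleMap g b' : ℂ) - SU11.circleMap g b‖ =
      ‖(b' : ℂ) - b‖ * (‖SU11.denom g b'‖⁻¹ * ‖SU11.denom g b‖⁻¹) := by
    change ‖SU11.mobius g b' - SU11.mobius g b‖ = _
    rw [SU11.mobius_sub_mobius g (hb b') (hb b), norm_div, norm_mul, div_eq_mul_inv, mul_inv]
  have h0 : ∀ b : Circle, poissonWave r (SU11.discMap g⁻¹ 0) b ≠ 0 := fun b => by
    rw [e, Ne, cpow_eq_zero_iff, ofReal_eq_zero]
    exact fun h' => (h b).ne' h'.1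
  have h1 := h0 b'
  have h2 := h0 b
  have es : 1 + 2 * I * r = 2 * (1 / 2 + I * r) := by ring
  have hcancel : ∀ X Y : ℂ, Y ≠ 0 → 1 / (X * Y) * Y = 1 / X := fun X Y hY => by
    rw [div_mul_eq_mul_div, one_mul, div_mul_cancel_right₀ hY, one_div]
  rw [psKernel, psKernel, es, e2, ofReal_mul, mul_cpow_ofReal_nonneg (norm_nonneg _)
    (mul_pos (h b') (h b)).le, ofReal_mul, mul_cpow_ofReal_nonneg (h b').le (h b).le, ← e, ← e]
  exact hcancel _ _ (mul_ne_zero h1 h2)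

/-! ### Weighted composition operators on smooth functions -/

/-- The operator `f ↦ (f ∘ g) w` on smooth functions. -/
def weightedComp (g : SU11) (w : SmoothB) : SmoothB →ₗ[ℂ] SmoothB where
  toFun f := ⟨fun b => f.1 (SU11.circleMap g b) * w.1 b, contMDiff_of_contDiff_exp (by
    obtain ⟨h, hh, e⟩ := SU11.exists_angle_lift g
    simp only [e]
    exact ((contDiff_comp_exp f).comp hh).mul (contDiff_comp_exp w))⟩
  map_add' f f' := by
    ext b
    exact add_mul _ _ _
  map_smul' c f := by
    ext b
    exact mul_assoc _ _ _

/-- Weighted composition is continuous for the `C ^ N` seminorms, by the Faà di Bruno bound for the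
composition with the angle lift and the Leibniz rule. -/
theorem weightedComp_bound (g : SU11) (w : SmoothB) (N : ℕ) :
    ∃ A : ℝ, ∀ (f : SmoothB) (M : ℝ),
      (∀ k ≤ N, ∀ θ : ℝ, ‖iteratedDeriv k (fun t : ℝ => f.1 (Circle.exp t)) θ‖ ≤ M) →
      ∀ k ≤ N, ∀ θ ∈ Set.Icc 0 (2 * Real.pi),
        ‖iteratedDeriv k (fun t : ℝ => (weightedComp g w f).1 (Circle.exp t)) θ‖ ≤ A * M := by
  obtain ⟨h, hh, e⟩ := SU11.exists_angle_lift g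
  have hB : ∀ {E : Type} [NormedAddCommGroup E] [NormedSpace ℝ E] (u : ℝ → E),
      ContDiff ℝ ∞ u → ∃ S, 1 ≤ S ∧ ∀ i ≤ N, ∀ θ ∈ Set.Icc 0 (2 * Real.pi),
        ‖iteratedFDeriv ℝ i u θ‖ ≤ S := by
    intro E _ _ u hu
    have : ∀ i : ℕ, ∃ B, ∀ θ ∈ Set.Icc 0 (2 * Real.pi), ‖iteratedFDeriv ℝ i u θ‖ ≤ B := fun i =>
      isCompact_Icc.exists_bound_of_continuousOn
        (hu.continuous_iteratedFDeriv (m := i) (natCast_le_infty i)).continuousOn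
    choose B hB using this
    refine ⟨1 + ∑ i ∈ Finset.range (N + 1), |B i|, ?_, fun i hi θ hθ => ?_⟩
    · linarith [Finset.sum_nonneg fun i (_ : i ∈ Finset.range (N + 1)) => abs_nonneg (B i)]
    · have := Finset.single_le_sum (f := fun i => |B i|) (fun _ _ => abs_nonneg _)
        (Finset.mem_range.2 (Nat.lt_succ_of_le hi))
      linarith [hB i θ hθ, le_abs_self (B i)]
  obtain ⟨D, hD1, hD⟩ := hB h hh
  obtain ⟨S, hS1, hS⟩ := hB _ (contDiff_comp_exp w)
  refine ⟨2 ^ N * (N.factorial * D ^ N * S), fun f M hM k hk θ hθ => ?_⟩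
  have hM0 : 0 ≤ M := (norm_nonneg _).trans (hM 0 (Nat.zero_le _) 0)
  have hcomp : ∀ i ≤ N, ‖iteratedFDeriv ℝ i ((fun t : ℝ => f.1 (Circle.exp t)) ∘ h) θ‖ ≤
      N.factorial * M * D ^ N := by
    intro i hi
    refine (norm_iteratedFDeriv_comp_le (contDiff_comp_exp f) hh (natCast_le_infty i) θ
      (C := M) (D := D) (fun j hj => ?_) fun j hj1 hj => ?_).trans ?_
    · rw [norm_iteratedFDeriv_eq_norm_iteratedDeriv]
      exact hM j (hj.trans hi) _
    · exact (hD j (hj.trans hi) θ hθ).trans (le_self_pow₀ hD1 (by omega))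
    · have := Nat.factorial_le hi
      gcongr
  have e' : (fun t : ℝ => (weightedComp g w f).1 (Circle.exp t)) =
      fun t => ((fun t : ℝ => f.1 (Circle.exp t)) ∘ h) t * w.1 (Circle.exp t) := by
    funext t
    change f.1 (SU11.circleMap g (Circle.exp t)) * _ = _
    rw [e, Function.comp]
  rw [e', ← norm_iteratedFDeriv_eq_norm_iteratedDeriv]
  refine (norm_iteratedFDeriv_mul_le ((contDiff_comp_exp f).comp hh) (contDiff_comp_exp w) θ
    (natCast_le_infty k)).trans ?_
  calc _ ≤ ∑ i ∈ Finset.range (k + 1), (k.choose i : ℝ) * (N.factorial * M * D ^ N) * S := by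
        refine Finset.sum_le_sum fun i hi => ?_
        rw [Finset.mem_range] at hi
        have h1 := hcomp i (by omega)
        have h2 := hS (k - i) (by omega) θ hθ
        gcongr
    _ = 2 ^ k * (N.factorial * D ^ N * S) * M := by
        rw [← Finset.sum_mul, ← Finset.sum_mul, ← Nat.cast_sum, Nat.sum_range_choose]
        push_cast
        ring
    _ ≤ _ := by
        gcongr
        norm_num

/-- The distribution `f ↦ T ((f ∘ g) w) - T f`, which measures the failure of `T` to be
equivariant. -/
def equivarianceDefect (T : BoundaryDistribution) (g : SU11) (w : SmoothB) :
    BoundaryDistribution where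
  toLinearMap := T.toLinearMap ∘ₗ weightedComp g w - T.toLinearMap
  bound := by
    obtain ⟨C, N, hC, hT⟩ := T.bound_period
    obtain ⟨A, hA⟩ := weightedComp_bound g w N
    refine ⟨C * A + C, N, fun f M hM => ?_⟩
    have h1 := hT (weightedComp g w f) (A * M) (hA f M hM)
    have h2 := hT f M fun k hk θ _ => hM k hk θ
    rw [LinearMap.sub_apply, LinearMap.comp_apply]
    refine (norm_sub_le _ _).trans ?_
    linarith

/-! ### Invariance of the Patterson-Sullivan distribution -/

/-- The boundary value of an invariant eigenfunction is equivariant: on plane waves this is the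
invariance of the eigenfunction, and plane waves determine a distribution. -/
theorem IsHelgasonBoundaryValue.equivariant {r : ℂ} (hr : ∀ n : ℕ, 1 / 2 + I * r ≠ -(n : ℂ))
    {φ : 𝔻 → ℂ} {T : BoundaryDistribution} (hT : IsHelgasonBoundaryValue r φ T) {g : SU11}
    (hφ : ∀ z : 𝔻, φ (SU11.discMap g z) = φ z) (f : SmoothB) :
    T.toLinearMap (weightedComp g ⟨_, poissonWave_mem r (SU11.discMap g⁻¹ 0)⟩ f) =
      T.toLinearMap f := by
  refine sub_eq_zero.1 (BoundaryDistribution.eq_zero_of_poissonWave hr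
    (equivarianceDefect T g ⟨_, poissonWave_mem r (SU11.discMap g⁻¹ 0)⟩) (fun z => ?_) f)
  change T.toLinearMap (weightedComp g _ _) - T.toLinearMap _ = 0
  have e : weightedComp g ⟨_, poissonWave_mem r (SU11.discMap g⁻¹ 0)⟩
      ⟨poissonWave r z, poissonWave_mem r z⟩ =
        ⟨poissonWave r (SU11.discMap g⁻¹ z), poissonWave_mem r (SU11.discMap g⁻¹ z)⟩ := by
    refine Subtype.ext (funext fun b => ?_)
    change poissonWave r z (SU11.circleMap g b) * poissonWave r (SU11.discMap g⁻¹ 0) b =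
      poissonWave r (SU11.discMap g⁻¹ z) b
    rw [poissonWave_discMap_inv_zero, ← poissonWave_discMap r g (SU11.discMap g⁻¹ z),
      SU11.discMap_discMap_inv]
  rw [e, ← hT, ← hT, ← hφ (SU11.discMap g⁻¹ z), SU11.discMap_discMap_inv, sub_self]

end PattersonSullivan

end

open PattersonSullivan
theorem proposition3p3
    (Γ : Subgroup SU11) (r : ℂ)
    (hr : ∀ n : ℕ, 1 / 2 + I * r ≠ -(n : ℂ))
    (φ : 𝔻 → ℂ) (hφ : ∀ γ ∈ Γ, ∀ z : 𝔻, φ (SU11.discMap γ z) = φ z)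
    (T : BoundaryDistribution) (hT : IsHelgasonBoundaryValue r φ T) :
    (psDistribution r T).IsInvariant Γ ∧ (psDistribution r T).IsTimeReversalInvariant := by
  -- pairing with the translate of `F` is pairing with the weighted composition of each slice
  refine ⟨fun γ hγ F => ?_, psDistribution_isTimeReversalInvariant r T⟩
  have hequiv := hT.equivariant hr (hφ γ hγ)
  change T.toLinearMap _ = T.toLinearMap _
  rw [← hequiv (OffDiagTest.psInner r T F)]
  congr 1
  ext b'
  change T.toLinearMap (OffDiagTest.slice r (OffDiagTest.translate γ F) b') =
    T.toLinearMap (OffDiagTest.slice r F (SU11.circleMap γ b')) *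
      poissonWave r (SU11.discMap γ⁻¹ 0) b'
  rw [← hequiv (OffDiagTest.slice r F (SU11.circleMap γ b')), mul_comm, ← smul_eq_mul, ← map_smul]
  congr 1
  ext b
  change F.1 (SU11.circleMap γ b', SU11.circleMap γ b) * psKernel r b' b =
    poissonWave r (SU11.discMap γ⁻¹ 0) b' * (F.1 (SU11.circleMap γ b', SU11.circleMap γ b) *
      psKernel r (SU11.circleMap γ b') (SU11.circleMap γ b) *
        poissonWave r (SU11.discMap γ⁻¹ 0) b)
  rw [← psKernel_circleMap r γ b' b]
  ring
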